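/- **Setting.** Let $G=(V,E)$ be a finite graph with an arbitrary ordering $v_1,\dots,v_n$ of its vertices, let $1\le k\le n$, and let $(X_v)_{v\in V}$ be independent nonnegative random variables with finite expectation. A partition of $V$ into $k$ parts means a partition into exactly $k$ nonempty parts. For a partition $\mathcal P=\{V_1,\dots,V_k\}$ put $\mathrm{cost}(\mathcal P)=\mathbb E\big[\max_{1\le j\le k}\sum_{v\in V_j}X_v\big]$, and let $\mathrm{Opt}_S$ be the minimum of $\mathrm{cost}$ over all partitions of $V$ into $k$ parts. *Dynamic Partition.* Given weights $w(v)$, with $A=\frac1k\sum_v w(v)$, and a number $\varepsilon$, the algorithm fills two tables $\mathrm{Parts}(s,t)$ and $\mathrm{Cut}(s,t)$, $0\le s\le n$, $0\le t\le k$. Initially $\mathrm{Parts}(s,t)=\emptyset$ and $\mathrm{Cut}(s,t)=\infty$, except that $\mathrm{Cut}(0,0)=0$. For $t=1,\dots,k$ and $s=t,\dots,n-k+t$ it lets $r$ minimize $$\mathrm{Cut}(j-1,t-1)+\delta(\{v_1,\dots,v_{j-1}\},\{v_j,\dots,v_s\})$$ over all $1\le j\le s$ for which $\sum_{i=j}^s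 w(v_i)\le(1+\varepsilon)A$ and this value is finite, where $\delta(B,B')$ is the number of edges between $B$ and $B'$; ties are broken arbitrarily. It sets $\mathrm{Parts}(s,t)=\mathrm{Parts}(r-1,t-1)\cup\{\{v_r,\dots,v_s\}\}$, and it sets $\mathrm{Cut}(s,t)$ to the number of edges joining different parts of $\mathrm{Parts}(s,t)$; if there is no such $j$, the entries keep their initial values. The instance is feasible if $\mathrm{Cut}(n,k)<\infty$, and then $\mathrm{Parts}(n,k)$ is returned. *Stochastic Partition.* For an integer $i$ put $N_{v,i}=X_v\mathbf 1_{\{X_v\le 2^i\}}$, $S_{v,i}=X_v\mathbf 1_{\{X_v>2^i\}}$, $w_{v,i}=\log\mathbb E[k^{N_{v,i}/2^i}]/\log k$ (read as $0$ if $k=1$), and $\varepsilon_i=(18k-\sum_v w_{v,i})/\sum_v w_{v,i}$ (read as $0$ if the denominator is $0$). Call $i$ *accepted* if $\sum_v\mathbb E[S_{v,i}/2^i]\le1$ and Dynamic Partition with weights $w_{v,i}$ and $\varepsilon=\varepsilon_i$ is feasible. The algorithm returns the output of Dynamic Partition with weights $w_{v,i^*}$ and $\varepsilon=\varepsilon_{i^*}$,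 where $i^*$ is the least accepted index in the range of $i$ that is searched. **Theorem.** There is an absolute constant $C>0$ such that, for every such graph, ordering, tie-breaking, $k$ and $(X_v)$: 1. If $i$ ranges over $0,1,2,\dots$, then Stochastic Partition returns a partition $\mathcal P$ of $V$ into $k$ parts with $\mathrm{cost}(\mathcal P)\le C\max(1,\mathrm{Opt}_S)$; and if $i=0$ is not accepted (that is, $i^*\ge1$), then $\mathrm{cost}(\mathcal P)\le C\cdot\mathrm{Opt}_S$. In particular, $\mathrm{cost}(\mathcal P)\le C\cdot\mathrm{Opt}_S$ whenever the unit is chosen so that $\mathrm{Opt}_S\ge1$. 2. If $i$ ranges over all integers and not all $X_v$ are almost surely $0$, then Stochastic Partition returns a partition $\mathcal P$ of $V$ into $k$ parts with $\mathrm{cost}(\mathcal P)\le C\cdot\mathrm{Opt}_S$. -/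

import Mathlib

open MeasureTheory ProbabilityTheory

namespace StochPart

noncomputable section

/-! ### Dynamic programming over an ordered vertex set -/

section Dynamic

variable {V : Type*} [Fintype V] [DecidableEq V]

/-- The position `1, …, n` of a vertex in the ordering `v₁, …, vₙ`. -/
def pos (ord : Fin (Fintype.card V) ≃ V) (v : V) : ℕ := (ord.symm v : ℕ) + 1

/-- The block `{v_j, …, v_s}`. -/
def block (ord : Fin (Fintype.card V) ≃ V) (j s : ℕ) : Finset V :=
  Finset.univ.filter fun v => j ≤ pos ord v ∧ pos ord v ≤ s

/-- The number of edges of `G` with one end in `A` and the other in `B`. -/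
def edgesBetween (G : SimpleGraph V) (A B : Finset V) : ℕ :=
  {e : Sym2 V | e ∈ G.edgeSet ∧ ∃ a ∈ A, ∃ b ∈ B, e = s(a, b)}.ncard

/-- The number of cut edges of a family of disjoint parts, in the subgraph induced by its union:
edges of `G` whose two ends lie in two different parts. -/
def cutEdges (G : SimpleGraph V) (parts : Finset (Finset V)) : ℕ :=
  {e : Sym2 V | e ∈ G.edgeSet ∧
    ∃ A ∈ parts, ∃ B ∈ parts, A ≠ B ∧ ∃ a ∈ A, ∃ b ∈ B, e = s(a, b)}.ncard

/-- A rule for choosing one minimizer `r` among all minimizers in the step that fills the table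
entry with indices `s` and `t`. -/
structure TieBreak where
  pick : ℕ → ℕ → Finset ℕ → ℕ
  pick_mem : ∀ s t (S : Finset ℕ), S.Nonempty → pick s t S ∈ S

/-- The table entry `Cut`, computed from the table entry `Parts`; it is `∞` where the latter is
unset. -/
def cutValue (G : SimpleGraph V) : Option (Finset (Finset V)) → ℕ∞
  | none => ⊤
  | some parts => (cutEdges G parts : ℕ∞)

/-- The value `Cut(j-1,t-1) + δ({v₁,…,v_{j-1}},{v_j,…,v_s})` of the candidate `j`, where `prev` is
the column `Parts(·,t-1)` of the table. -/
def candidateValue (G : SimpleGraph V) (ord : Fin (Fintype.card V) ≃ V)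
    (prev : ℕ → Option (Finset (Finset V))) (s j : ℕ) : ℕ∞ :=
  cutValue G (prev (j - 1)) + (edgesBetween G (block ord 1 (j - 1)) (block ord j s) : ℕ∞)

open Classical in
/-- The candidates `1 ≤ j ≤ s` with `∑_{i=j}^s w(v_i) ≤ (1+ε)A`, `A = (1/k) ∑_v w(v)`,
which have a finite value. -/
def candidates (G : SimpleGraph V) (ord : Fin (Fintype.card V) ≃ V) (k : ℕ) (w : V → ℝ) (ε : ℝ)
    (prev : ℕ → Option (Finset (Finset V))) (s : ℕ) : Finset ℕ :=
  (Finset.Icc 1 s).filter fun j =>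
    ∑ v ∈ block ord j s, w v ≤ (1 + ε) * ((1 / (k : ℝ)) * ∑ v, w v) ∧
      candidateValue G ord prev s j < ⊤

open Classical in
/-- The candidates of least value. -/
def minimizers (G : SimpleGraph V) (ord : Fin (Fintype.card V) ≃ V) (k : ℕ) (w : V → ℝ) (ε : ℝ)
    (prev : ℕ → Option (Finset (Finset V))) (s : ℕ) : Finset ℕ :=
  (candidates G ord k w ε prev s).filter fun j =>
    ∀ j' ∈ candidates G ord k w ε prev s,
      candidateValue G ord prev s j ≤ candidateValue G ord prev s j'

open Classical in
/-- The table `Parts`: `partsTable … t s` is the entry `Parts(s,t)`, and `none` is an entry that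
is never set (so that `Cut(s,t) = ∞`). -/
def partsTable (G : SimpleGraph V) (ord : Fin (Fintype.card V) ≃ V) (τ : TieBreak) (k : ℕ)
    (w : V → ℝ) (ε : ℝ) : ℕ → ℕ → Option (Finset (Finset V))
  | 0, s => if s = 0 then some ∅ else none
  | t + 1, s =>
    let prev := partsTable G ord τ k w ε t
    let M := minimizers G ord k w ε prev s
    if t + 1 ≤ s ∧ s + k ≤ Fintype.card V + (t + 1) ∧ M.Nonempty then
      let r := τ.pick s (t + 1) M
      (prev (r - 1)).map fun parts => insert (block ord r s) parts
    else none

/-- Dynamic Partition, with the upper constraint on the part weights only. The result is `none`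
if the instance is found to be infeasible, and otherwise the set of parts. -/
def dynamicPartition (G : SimpleGraph V) (ord : Fin (Fintype.card V) ≃ V) (τ : TieBreak) (k : ℕ)
    (w : V → ℝ) (ε : ℝ) : Option (Finset (Finset V)) :=
  partsTable G ord τ k w ε k (Fintype.card V)

end Dynamic

/-! ### Stochastic weights -/

section Stochastic

variable {V : Type*} {Ω : Type*} [MeasurableSpace Ω]

open Classical in
/-- `N_{v,i} = X_v · 1{X_v ≤ 2^i}`. -/
def normalPart (X : V → Ω → ℝ) (i : ℤ) (v : V) (ω : Ω) : ℝ :=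
  if X v ω ≤ (2 : ℝ) ^ i then X v ω else 0

open Classical in
/-- `S_{v,i} = X_v · 1{X_v > 2^i}`. -/
def exceptionalPart (X : V → Ω → ℝ) (i : ℤ) (v : V) (ω : Ω) : ℝ :=
  if (2 : ℝ) ^ i < X v ω then X v ω else 0

/-- The effective bandwidth `β_{1/k}(Y) = log E[k^Y] / log k`
(which is `0` for `k = 1`, since division by zero gives `0`). -/
def effectiveBandwidth (μ : Measure Ω) (k : ℕ) (Y : Ω → ℝ) : ℝ :=
  Real.log (∫ ω, (k : ℝ) ^ Y ω ∂μ) / Real.log k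

/-- `w_{v,i} = β_{1/k}(N_{v,i} / 2^i)`. -/
def vertexWeight (μ : Measure Ω) (X : V → Ω → ℝ) (k : ℕ) (i : ℤ) (v : V) : ℝ :=
  effectiveBandwidth μ k fun ω => normalPart X i v ω / (2 : ℝ) ^ i

variable [Fintype V] [DecidableEq V]

/-- `ε_i = (18 k - ∑_v w_{v,i}) / ∑_v w_{v,i}`. -/
def balanceParam (μ : Measure Ω) (X : V → Ω → ℝ) (k : ℕ) (i : ℤ) : ℝ :=
  (18 * (k : ℝ) - ∑ v, vertexWeight μ X k i v) / ∑ v, vertexWeight μ X k i v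

/-- The call of Dynamic Partition at scale `2^i`. -/
def partitionAtScale (G : SimpleGraph V) (ord : Fin (Fintype.card V) ≃ V) (τ : TieBreak)
    (μ : Measure Ω) (X : V → Ω → ℝ) (k : ℕ) (i : ℤ) : Option (Finset (Finset V)) :=
  dynamicPartition G ord τ k (vertexWeight μ X k i) (balanceParam μ X k i)

/-- The stopping condition: `∑_v E[S_{v,i} / 2^i] ≤ 1` and Dynamic Partition is feasible at
scale `2^i`. -/
def ScaleAccepted (G : SimpleGraph V) (ord : Fin (Fintype.card V) ≃ V) (τ : TieBreak)
    (μ : Measure Ω) (X : V → Ω → ℝ) (k : ℕ) (i : ℤ) : Prop :=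
  (∑ v, ∫ ω, exceptionalPart X i v ω / (2 : ℝ) ^ i ∂μ) ≤ 1 ∧
    partitionAtScale G ord τ μ X k i ≠ none

open Classical in
/-- Stochastic Partition with scales `2^i`, `i ∈ I`: the result of Dynamic Partition at the least
accepted index `i* ∈ I`, and `none` if there is no least accepted index. -/
def stochasticPartition (I : Set ℤ) (G : SimpleGraph V) (ord : Fin (Fintype.card V) ≃ V)
    (τ : TieBreak) (μ : Measure Ω) (X : V → Ω → ℝ) (k : ℕ) : Option (Finset (Finset V)) :=
  if h : ∃ i, IsLeast {i : ℤ | i ∈ I ∧ ScaleAccepted G ord τ μ X k i} i then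
    partitionAtScale G ord τ μ X k h.choose
  else none

/-- `E[max_i ∑_{v ∈ V_i} X_v]` for a partition of the vertex set. -/
def expectedMax (μ : Measure Ω) (X : V → Ω → ℝ)
    (P : Finpartition (Finset.univ : Finset V)) : ℝ :=
  ∫ ω, ⨆ B : P.parts, ∑ v ∈ (B : Finset V), X v ω ∂μ

/-- The minimum of `E[max_i ∑_{v ∈ B_i} X_v]` over all (finitely many) partitions of the vertex
set into `k` parts. -/
def optS (μ : Measure Ω) (X : V → Ω → ℝ) (k : ℕ) : ℝ :=
  ⨅ P : {P : Finpartition (Finset.univ : Finset V) // P.parts.card = k}, expectedMax μ X P.1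

end Stochastic

end

end StochPart

/-! At each scale `2^i` the effective bandwidths compare with the cost in both directions.

Lower bound: if some partition into k parts costs at most `2^i/16`, the weights total at most 17k
(`sum_vertexWeight_le`). Markov's inequality and independence make the probabilities that individual
parts, or individual variables, reach about `2^i/4` sum to at most 1/3. For each part,
`integral_rpow_sum_tail_le` turns such a tail probability into a bound on an exponential moment of
its small variables. A cost this low also keeps the exceptional parts below the threshold
(`half_le_integral_of_le_sum_exceptionalPart`). Since every weight is at most 1, greedy consecutive
blocks fit under 18 = 17 + 1, so Dynamic Partition is feasible (`dynamicPartition_ne_none`). Hence a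
rejected scale has `2^i ≤ 16 Opt`.

Upper bound: at an accepted scale every returned part has weight at most 18, so its normal part, in
units of `2^i`, has k-exponential moment at most `k^18`. One further unit in the exponent pays for
the sum over k parts, and the cost is at most `22 * 2^i` (`expectedMax_le`). For k = 1 bandwidths
carry no information, but there is only one partition.

The least accepted scale above the bottom of the range follows a rejected one, which gives the
constant. At the bottom of the range `i ≥ 0`, the maximum with 1 takes over; over all integers, a
variable of positive mean bounds the accepted scales below. Cut values enter only through their
finiteness, so minimization and tie-breaking do not affect the cost bound. -/

namespace StochPart

/-! ### Dynamic Partition: shape of the table entries and feasibility. -/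

section Dynamic

variable {V : Type*} [Fintype V]

lemma mem_block {ord : Fin (Fintype.card V) ≃ V} {j s : ℕ} {v : V} :
    v ∈ block ord j s ↔ j ≤ pos ord v ∧ pos ord v ≤ s := by
  simp [block]

lemma one_le_pos (ord : Fin (Fintype.card V) ≃ V) (v : V) : 1 ≤ pos ord v := by
  simp [pos]

lemma pos_le_card (ord : Fin (Fintype.card V) ≃ V) (v : V) : pos ord v ≤ Fintype.card V := by
  have := (ord.symm v).isLt
  simp only [pos]
  omega

lemma pos_injective (ord : Fin (Fintype.card V) ≃ V) : Function.Injective (pos ord) := by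
  intro a b h
  simp only [pos, add_left_inj] at h
  exact ord.symm.injective (Fin.ext h)

lemma exists_pos_eq (ord : Fin (Fintype.card V) ≃ V) {s : ℕ} (h1 : 1 ≤ s)
    (h2 : s ≤ Fintype.card V) : ∃ v, pos ord v = s := by
  refine ⟨ord ⟨s - 1, by omega⟩, ?_⟩
  simp only [pos, Equiv.symm_apply_apply]
  omega

lemma block_one_zero (ord : Fin (Fintype.card V) ≃ V) : block ord 1 0 = ∅ := by
  ext v
  have := one_le_pos ord v
  simp only [mem_block, Finset.notMem_empty, iff_false]
  omega

lemma sum_block_self_le (ord : Fin (Fintype.card V) ≃ V) {w : V → ℝ} {m : ℝ}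
    (hm : ∀ v, w v ≤ m) (hm0 : 0 ≤ m) (s : ℕ) : ∑ v ∈ block ord s s, w v ≤ m := by
  have hc : (block ord s s).card ≤ 1 := by
    rw [Finset.card_le_one]
    intro a ha b hb
    rw [mem_block] at ha hb
    exact pos_injective ord (by omega)
  calc ∑ v ∈ block ord s s, w v ≤ (block ord s s).card • m :=
        Finset.sum_le_card_nsmul _ _ _ fun v _ => hm v
    _ ≤ m := by
        rw [nsmul_eq_mul]
        have : ((block ord s s).card : ℝ) ≤ 1 := by exact_mod_cast hc
        nlinarith

lemma candidateValue_lt_top {G : SimpleGraph V} {ord : Fin (Fintype.card V) ≃ V}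
    {prev : ℕ → Option (Finset (Finset V))} {s j : ℕ} :
    candidateValue G ord prev s j < ⊤ ↔ prev (j - 1) ≠ none := by
  unfold candidateValue
  cases h : prev (j - 1) <;> simp [cutValue, ENat.add_lt_top]

lemma minimizers_nonempty {G : SimpleGraph V} {ord : Fin (Fintype.card V) ≃ V} {k : ℕ}
    {w : V → ℝ} {ε : ℝ} {prev : ℕ → Option (Finset (Finset V))} {s : ℕ}
    (h : (candidates G ord k w ε prev s).Nonempty) : (minimizers G ord k w ε prev s).Nonempty := by
  obtain ⟨j, hj, hmin⟩ := Finset.exists_min_image _ (candidateValue G ord prev s) h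
  exact ⟨j, by simpa [minimizers] using ⟨hj, hmin⟩⟩

lemma mem_minimizers_iff {G : SimpleGraph V} {ord : Fin (Fintype.card V) ≃ V} {k : ℕ}
    {w : V → ℝ} {ε : ℝ} {prev : ℕ → Option (Finset (Finset V))} {s j : ℕ} :
    j ∈ minimizers G ord k w ε prev s ↔ j ∈ candidates G ord k w ε prev s ∧
      ∀ j' ∈ candidates G ord k w ε prev s,
        candidateValue G ord prev s j ≤ candidateValue G ord prev s j' := by
  simp [minimizers]

lemma mem_candidates_iff {G : SimpleGraph V} {ord : Fin (Fintype.card V) ≃ V} {k : ℕ}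
    {w : V → ℝ} {ε : ℝ} {prev : ℕ → Option (Finset (Finset V))} {s j : ℕ} :
    j ∈ candidates G ord k w ε prev s ↔ (1 ≤ j ∧ j ≤ s) ∧
      ∑ v ∈ block ord j s, w v ≤ (1 + ε) * ((1 / (k : ℝ)) * ∑ v, w v) ∧ prev (j - 1) ≠ none := by
  simp [candidates, candidateValue_lt_top]

variable [DecidableEq V]

lemma sum_block_one (ord : Fin (Fintype.card V) ≃ V) (w : V → ℝ) {r s : ℕ} (h : r ≤ s) :
    ∑ v ∈ block ord 1 s, w v = ∑ v ∈ block ord 1 r, w v + ∑ v ∈ block ord (r + 1) s, w v := by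
  rw [← Finset.sum_union]
  · congr 1
    ext v
    have := one_le_pos ord v
    simp only [mem_block, Finset.mem_union]
    omega
  · rw [Finset.disjoint_left]
    intro v
    simp only [mem_block]
    omega

/-- What a finite table entry `Parts(s,t)` contains. -/
structure IsIntervalPartition (ord : Fin (Fintype.card V) ≃ V) (w : V → ℝ) (b : ℝ) (t s : ℕ)
    (parts : Finset (Finset V)) : Prop where
  card : parts.card = t
  nonempty : ∀ B ∈ parts, B.Nonempty
  weight : ∀ B ∈ parts, ∑ v ∈ B, w v ≤ b
  disjoint : (parts : Set (Finset V)).PairwiseDisjoint id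
  cover : ∀ v, pos ord v ≤ s ↔ ∃ B ∈ parts, v ∈ B

/-- Induction on the row. The only fact used about the chosen index is that it is a candidate, so
its block obeys the weight bound and starts just after the prefix already covered. -/
lemma isIntervalPartition_of_partsTable (G : SimpleGraph V) (ord : Fin (Fintype.card V) ≃ V)
    (τ : TieBreak) (k : ℕ) (w : V → ℝ) (ε : ℝ) (t s : ℕ) (parts : Finset (Finset V))
    (hs : s ≤ Fintype.card V) (h : partsTable G ord τ k w ε t s = some parts) :
    IsIntervalPartition ord w ((1 + ε) * ((1 / (k : ℝ)) * ∑ v, w v)) t s parts := by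
  induction t generalizing s parts with
  | zero =>
    simp only [partsTable, Option.ite_none_right_eq_some, Option.some.injEq] at h
    obtain ⟨rfl, rfl⟩ := h
    refine ⟨by simp, by simp, by simp, by simp, fun v => ?_⟩
    have := one_le_pos ord v
    simp only [Finset.notMem_empty, false_and, exists_false, iff_false]
    omega
  | succ t ih =>
    simp only [partsTable, Option.ite_none_right_eq_some] at h
    obtain ⟨⟨h1, h2, hM⟩, h⟩ := h
    have hr := τ.pick_mem s (t + 1) _ hM
    generalize τ.pick s (t + 1) _ = r at h hr
    rw [mem_minimizers_iff, mem_candidates_iff] at hr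
    obtain ⟨⟨⟨hr1, hrs⟩, hw, -⟩, -⟩ := hr
    obtain ⟨p, hp, rfl⟩ := Option.map_eq_some_iff.1 h
    have H := ih (r - 1) p (by omega) hp
    have hdis : ∀ B ∈ p, Disjoint (block ord r s) B := by
      intro B hB
      rw [Finset.disjoint_left]
      intro v hv hvB
      have := (H.cover v).2 ⟨B, hB, hvB⟩
      rw [mem_block] at hv
      omega
    have hne : (block ord r s).Nonempty := by
      obtain ⟨v, hv⟩ := exists_pos_eq ord (s := s) (by omega) hs
      exact ⟨v, by rw [mem_block]; omega⟩
    have hnot : block ord r s ∉ p := fun hB => by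
      have := hdis _ hB
      rw [disjoint_self] at this
      exact hne.ne_empty this
    refine ⟨?_, ?_, ?_, ?_, fun v => ?_⟩
    · rw [Finset.card_insert_of_notMem hnot, H.card]
    · intro B hB
      rcases Finset.mem_insert.1 hB with rfl | hB
      exacts [hne, H.nonempty B hB]
    · intro B hB
      rcases Finset.mem_insert.1 hB with rfl | hB
      exacts [hw, H.weight B hB]
    · rw [Finset.coe_insert, Set.pairwiseDisjoint_insert]
      exact ⟨H.disjoint, fun B hB _ => hdis B hB⟩
    · rw [Finset.exists_mem_insert, ← H.cover v, mem_block]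
      omega

lemma exists_finpartition_of_dynamicPartition (G : SimpleGraph V)
    (ord : Fin (Fintype.card V) ≃ V) (τ : TieBreak) (k : ℕ) (w : V → ℝ) (ε : ℝ)
    (h : dynamicPartition G ord τ k w ε ≠ none) :
    ∃ P : Finpartition (Finset.univ : Finset V),
      dynamicPartition G ord τ k w ε = some P.parts ∧ P.parts.card = k ∧
      ∀ B ∈ P.parts, ∑ v ∈ B, w v ≤ (1 + ε) * ((1 / (k : ℝ)) * ∑ v, w v) := by
  obtain ⟨parts, hp⟩ := Option.ne_none_iff_exists'.1 h
  have H := isIntervalPartition_of_partsTable G ord τ k w ε k _ parts le_rfl hp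
  refine ⟨⟨parts, Finset.supIndep_iff_pairwiseDisjoint.2 H.disjoint, ?_, ?_⟩, hp, H.card, H.weight⟩
  · ext v
    have := (H.cover v).1 (pos_le_card ord v)
    simpa [Finset.mem_sup] using this
  · intro hb
    exact (H.nonempty _ hb).ne_empty rfl

lemma partsTable_succ_ne_none {G : SimpleGraph V} {ord : Fin (Fintype.card V) ≃ V}
    {τ : TieBreak} {k : ℕ} {w : V → ℝ} {ε : ℝ} {t r s : ℕ}
    (h : partsTable G ord τ k w ε t r ≠ none) (hrs : r < s) (hts : t + 1 ≤ s)
    (hsk : s + k ≤ Fintype.card V + (t + 1))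
    (hw : ∑ v ∈ block ord (r + 1) s, w v ≤ (1 + ε) * ((1 / (k : ℝ)) * ∑ v, w v)) :
    partsTable G ord τ k w ε (t + 1) s ≠ none := by
  have hM : (minimizers G ord k w ε (partsTable G ord τ k w ε t) s).Nonempty :=
    minimizers_nonempty ⟨r + 1, mem_candidates_iff.2 ⟨⟨by omega, hrs⟩, hw, h⟩⟩
  have hr := τ.pick_mem s (t + 1) _ hM
  rw [mem_minimizers_iff, mem_candidates_iff] at hr
  simp only [partsTable]
  rw [if_pos ⟨hts, hsk, hM⟩]
  simpa using hr.1.2.2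

/-- Dynamic Partition is feasible as soon as the bound on the part weights exceeds their average
by the largest vertex weight. -/
lemma dynamicPartition_ne_none (G : SimpleGraph V) (ord : Fin (Fintype.card V) ≃ V)
    (τ : TieBreak) {k : ℕ} (hk : 1 ≤ k) (hkn : k ≤ Fintype.card V) {w : V → ℝ} {ε m : ℝ}
    (hm0 : 0 ≤ m) (hm : ∀ v, w v ≤ m)
    (hb : (1 / (k : ℝ)) * ∑ v, w v + m ≤ (1 + ε) * ((1 / (k : ℝ)) * ∑ v, w v))
    (hw0 : ∀ v, 0 ≤ w v) :
    dynamicPartition G ord τ k w ε ≠ none := by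
  set A := (1 / (k : ℝ)) * ∑ v, w v with hAdef
  have hA0 : 0 ≤ A := by
    have := Finset.sum_nonneg fun v (_ : v ∈ Finset.univ) => hw0 v
    positivity
  set F : ℕ → ℝ := fun s => ∑ v ∈ block ord 1 s, w v with hF
  -- Greedy invariant: either `s` is the last position that row `t` allows, or the prefix already
  -- weighs at least `t * A`. Strictness for `t > 0` is what gives the contradiction in row `k`.
  have key : ∀ t, t ≤ k → ∃ s, partsTable G ord τ k w ε t s ≠ none ∧ t ≤ s ∧
      s + k ≤ Fintype.card V + t ∧
      (s + k = Fintype.card V + t ∨ (t * A ≤ F s ∧ (0 < t → t * A < F s))) := by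
    intro t
    induction t with
    | zero =>
      intro _
      exact ⟨0, by simp [partsTable], le_rfl, by omega, Or.inr ⟨by simp [hF, block_one_zero],
        by simp⟩⟩
    | succ t ih =>
      intro ht
      obtain ⟨r, hr, htr, hrk, hdisj⟩ := ih (by omega)
      let p : ℕ → Prop := fun s => r < s ∧ F s - F r ≤ (1 + ε) * A
      have hp1 : p (r + 1) := by
        refine ⟨by omega, ?_⟩
        have h1 := sum_block_one ord w (Nat.le_succ r)
        have h2 := sum_block_self_le ord hm hm0 (r + 1)
        simp only [hF, Nat.succ_eq_add_one] at *
        linarith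
      classical
      set N := Fintype.card V + (t + 1) - k with hN
      have hle : r + 1 ≤ N := by omega
      -- The longest admissible next block, capped so that enough vertices remain for the later
      -- parts.
      set s := Nat.findGreatest p N with hs
      have hps : p s := Nat.findGreatest_spec hle hp1
      have hsN : s ≤ N := Nat.findGreatest_le N
      have hblk := sum_block_one ord w hps.1.le
      refine ⟨s, partsTable_succ_ne_none hr hps.1 (by have := hps.1; omega) (by omega) ?_,
        by have := hps.1; omega, by omega, ?_⟩
      · have := hps.2
        simp only [hF] at this
        linarith
      · rcases hsN.eq_or_lt with h | h
        · left; omega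
        · right
          have hnp : ¬ p (s + 1) := Nat.findGreatest_is_greatest (Nat.lt_succ_self _) (by omega)
          -- Stopping before the cap means one more vertex would break the bound; that vertex weighs
          -- at most `m`, so the block itself weighs more than `A`.
          have hgt : (1 + ε) * A < F (s + 1) - F r := by
            by_contra hcon
            exact hnp ⟨by have := hps.1; omega, not_lt.1 hcon⟩
          have h1 := sum_block_one ord w (Nat.le_succ s)
          have h2 := sum_block_self_le ord hm hm0 (s + 1)
          have h3 : F (s + 1) ≤ F s + m := by
            simp only [hF, Nat.succ_eq_add_one] at *
            linarith
          rcases hdisj with hd | hd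
          -- If the previous endpoint was the last allowed in its row, `r < s` already puts `s` at
          -- the cap.
          · exfalso
            have := hps.1
            omega
          · have : ((t + 1 : ℕ) : ℝ) * A < F s := by
              push_cast
              linarith [hd.1]
            exact ⟨this.le, fun _ => this⟩
  obtain ⟨s, hs, -, hsn, hd⟩ := key k le_rfl
  have hsn' : s = Fintype.card V := by
    rcases hd with hd | hd
    · omega
    -- The prefix would weigh more than `k * A`, which is the total weight.
    · have h1 := hd.2 (by omega)
      have h2 : (k : ℝ) * A = ∑ v, w v := by
        rw [hAdef]
        have : (k : ℝ) ≠ 0 := by positivity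
        field_simp
      have h3 : F s ≤ ∑ v, w v :=
        Finset.sum_le_sum_of_subset_of_nonneg (Finset.subset_univ _) fun v _ _ => hw0 v
      linarith
  rw [hsn'] at hs
  exact hs

end Dynamic

/-! ### Independent events determined by disjoint sets of coordinates. -/

section Independence

variable {V Ω : Type*} [MeasurableSpace Ω] {μ : Measure Ω} {X : V → Ω → ℝ}

lemma indepFun_of_dependsOn (h : iIndepFun X μ) (hX : ∀ v, Measurable (X v))
    {α β : Type*} [MeasurableSpace α] [MeasurableSpace β]
    {S T : Finset V} (hST : Disjoint S T) {F : (V → ℝ) → α} {H : (V → ℝ) → β}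
    (hF : Measurable F) (hH : Measurable H) (hFS : DependsOn F (S : Set V))
    (hHT : DependsOn H (T : Set V)) :
    IndepFun (fun ω => F fun v => X v ω) (fun ω => H fun v => X v ω) μ := by
  classical
  -- Extension by zero lets a function of all coordinates be read as a function of those in `U`; by
  -- `DependsOn` the filler is irrelevant.
  have hext : ∀ U : Finset V, Measurable fun (x : U → ℝ) (v : V) =>
      if hv : v ∈ U then x ⟨v, hv⟩ else 0 := by
    intro U
    refine measurable_pi_lambda _ fun v => ?_
    by_cases hv : v ∈ U
    · simpa [hv] using measurable_pi_apply _
    · simp [hv]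
  have := (h.indepFun_finset S T hST hX).comp (hF.comp (hext S)) (hH.comp (hext T))
  convert this using 1
  · ext ω
    exact hFS fun v hv => by simp [Finset.mem_coe.1 hv]
  · ext ω
    exact hHT fun v hv => by simp [Finset.mem_coe.1 hv]

lemma integral_prod_comp_finset (h : iIndepFun X μ) (hX : ∀ v, Measurable (X v)) {f : ℝ → ℝ}
    (hf : Measurable f) (s : Finset V) :
    ∫ ω, ∏ v ∈ s, f (X v ω) ∂μ = ∏ v ∈ s, ∫ ω, f (X v ω) ∂μ := by
  have h1 := (h.precomp (g := fun v : s => (v : V)) Subtype.val_injective).integral_fun_prod_comp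
    (f := fun _ => f) (fun v => (hX v).aemeasurable) fun _ => hf.aestronglyMeasurable
  rw [← Finset.prod_coe_sort s]
  rw [← h1]
  congr with ω
  rw [← Finset.prod_coe_sort s]

lemma measureReal_forall_mem_eq_prod [IsProbabilityMeasure μ] (h : iIndepFun X μ)
    (hX : ∀ v, Measurable (X v)) {ι : Type*} (J : Finset ι) (B : ι → Finset V)
    (hB : (J : Set ι).PairwiseDisjoint B) (A : ι → (V → ℝ) → Prop)
    (hA : ∀ j, Measurable (A j)) (hdep : ∀ j, DependsOn (A j) (B j : Set V)) :
    μ.real {ω | ∀ j ∈ J, A j fun v => X v ω} = ∏ j ∈ J, μ.real {ω | A j fun v => X v ω} := by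
  classical
  induction J using Finset.induction_on with
  | empty => simp
  | insert i J hi ih =>
    rw [Finset.prod_insert hi]
    rw [Finset.coe_insert, Set.pairwiseDisjoint_insert] at hB
    rw [← ih hB.1]
    have hmeas : Measurable fun x : V → ℝ => ∀ j ∈ J, A j x := by
      rw [← measurableSet_setOfPred]
      simp only [Set.ofPred_forall]
      exact Finset.measurableSet_biInter _ fun j _ => measurableSet_setOfPred.2 (hA j)
    have hd : DependsOn (fun x : V → ℝ => ∀ j ∈ J, A j x) (J.biUnion B : Set V) := by
      intro x y hxy
      simp only [eq_iff_iff]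
      refine forall₂_congr fun j hj => ?_
      rw [hdep j fun v hv => hxy v ?_]
      simp only [Finset.coe_biUnion, Set.mem_iUnion]
      exact ⟨j, hj, hv⟩
    have hdis : Disjoint (B i) (J.biUnion B) := by
      rw [Finset.disjoint_biUnion_right]
      exact fun j hj => hB.2 j hj fun hij => hi (hij ▸ hj)
    have := (indepFun_of_dependsOn h hX hdis (hA i) hmeas (hdep i) hd).measure_inter_preimage_eq_mul
      {True} {True} (by trivial) (by trivial)
    rw [Measure.real, Measure.real, Measure.real, ← ENNReal.toReal_mul]
    convert congrArg ENNReal.toReal this using 3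
    · ext ω
      simp
    · congr 1
      ext ω
      simp
    · congr 1
      ext ω
      simp

/-- If a union of independent events is not likely, then the sum of their probabilities is
small. -/
lemma sum_measureReal_le_third [IsProbabilityMeasure μ] (h : iIndepFun X μ)
    (hX : ∀ v, Measurable (X v)) {ι : Type*} (J : Finset ι) (B : ι → Finset V)
    (hB : (J : Set ι).PairwiseDisjoint B) (A : ι → (V → ℝ) → Prop)
    (hA : ∀ j, Measurable (A j)) (hdep : ∀ j, DependsOn (A j) (B j : Set V))
    (hU : μ.real {ω | ∃ j ∈ J, ¬ A j fun v => X v ω} ≤ 1 / 4) :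
    ∑ j ∈ J, μ.real {ω | ¬ A j fun v => X v ω} ≤ 1 / 3 := by
  have hXm : Measurable fun ω v => X v ω := measurable_pi_lambda _ hX
  have hAm : ∀ j, MeasurableSet {ω | A j fun v => X v ω} := fun j =>
    measurableSet_setOfPred.2 ((hA j).comp hXm)
  have hc : ∀ j, μ.real {ω | A j fun v => X v ω} = 1 - μ.real {ω | ¬ A j fun v => X v ω} := by
    intro j
    have := probReal_compl_eq_one_sub (μ := μ) (hAm j)
    rw [Set.compl_ofPred] at this
    linarith
  have hall : MeasurableSet {ω | ∀ j ∈ J, A j fun v => X v ω} := by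
    simp only [Set.ofPred_forall]
    exact Finset.measurableSet_biInter _ fun j _ => hAm j
  have h1 : 3 / 4 ≤ μ.real {ω | ∀ j ∈ J, A j fun v => X v ω} := by
    have := probReal_compl_eq_one_sub (μ := μ) hall
    rw [Set.compl_ofPred] at this
    push Not at this
    linarith
  rw [measureReal_forall_mem_eq_prod h hX J B hB A hA hdep] at h1
  -- With `1 - p ≤ exp (-p)` the product, which is at least 3/4, is at most `exp (-σ)`; hence `1 + σ
  -- ≤ exp σ ≤ 4/3`.
  have h2 : ∏ j ∈ J, μ.real {ω | A j fun v => X v ω}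
      ≤ Real.exp (-∑ j ∈ J, μ.real {ω | ¬ A j fun v => X v ω}) := by
    rw [← Finset.sum_neg_distrib, Real.exp_sum]
    refine Finset.prod_le_prod (fun _ _ => measureReal_nonneg) fun j _ => ?_
    rw [hc]
    linarith [Real.add_one_le_exp (-μ.real {ω | ¬ A j fun v => X v ω})]
  set σ := ∑ j ∈ J, μ.real {ω | ¬ A j fun v => X v ω}
  have h3 : Real.exp (-σ) * Real.exp σ = 1 := by rw [← Real.exp_add]; simp
  have h4 := Real.add_one_le_exp σ
  nlinarith [Real.exp_pos σ]

end Independence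

/-! ### Exceptional parts against the expected maximum. -/

section Exceptional

variable {V Ω : Type*} [Fintype V] [MeasurableSpace Ω] {μ : Measure Ω} {X : V → Ω → ℝ}

lemma integral_ite_one_zero {p : Ω → Prop} [DecidablePred p] (hp : MeasurableSet {ω | p ω}) :
    ∫ ω, (if p ω then (1 : ℝ) else 0) ∂μ = μ.real {ω | p ω} := by
  rw [← integral_indicator_one hp]
  congr with ω
  simp [Set.indicator]

/-- A common upper bound of independent variables is at least half a threshold in expectation if
the exceptional parts reach the threshold. -/
lemma half_le_integral_of_le_sum_exceptionalPart [IsProbabilityMeasure μ] (h : iIndepFun X μ)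
    (hX : ∀ v, Measurable (X v)) (hXi : ∀ v, Integrable (X v) μ) {i : ℤ}
    {M : Ω → ℝ} (hM : Integrable M μ) (hM0 : ∀ ω, 0 ≤ M ω) (hXM : ∀ v ω, X v ω ≤ M ω)
    (hS : (2 : ℝ) ^ i ≤ ∑ v, ∫ ω, exceptionalPart X i v ω ∂μ) :
    (2 : ℝ) ^ i / 2 ≤ ∫ ω, M ω ∂μ := by
  classical
  have hτ : (0 : ℝ) < 2 ^ i := by positivity
  generalize hτd : (2 : ℝ) ^ i = τ at *
  set F : V → (V → ℝ) → ℝ := fun v x => if τ < x v then x v else 0 with hF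
  -- `F v * H v` is nonzero only when `v` is the unique vertex above the threshold. These events are
  -- disjoint, so the sum over `v` stays below `M`; and `H v` is independent of `F v` with mean at
  -- least `q`.
  set H : V → (V → ℝ) → ℝ := fun v x => if ∀ u ∈ Finset.univ.erase v, x u ≤ τ then 1 else 0 with hH
  have hexc : ∀ v ω, exceptionalPart X i v ω = F v (fun v => X v ω) := by
    intro v ω
    simp only [exceptionalPart, hτd, hF]
  have hFm : ∀ v, Measurable (F v) := fun v =>
    Measurable.ite (measurableSet_lt measurable_const (measurable_pi_apply v))
      (measurable_pi_apply v) measurable_const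
  have hset : ∀ s : Finset V, MeasurableSet {x : V → ℝ | ∀ u ∈ s, x u ≤ τ} := by
    intro s
    simp only [Set.ofPred_forall]
    exact Finset.measurableSet_biInter _ fun u _ =>
      measurableSet_le (measurable_pi_apply u) measurable_const
  have hHm : ∀ v, Measurable (H v) := fun v =>
    Measurable.ite (hset _) measurable_const measurable_const
  have hXm : Measurable fun ω v => X v ω := measurable_pi_lambda _ hX
  have hind : ∀ v, IndepFun (fun ω => F v fun v => X v ω) (fun ω => H v fun v => X v ω) μ := by
    intro v
    refine indepFun_of_dependsOn h hX (S := {v}) (T := Finset.univ.erase v) (by simp)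
      (hFm v) (hHm v) ?_ ?_
    · intro x y hxy
      simp [hF, hxy v (by simp)]
    · intro x y hxy
      simp only [hH]
      congr 1
      simp only [eq_iff_iff]
      exact forall₂_congr fun u hu => by rw [hxy u hu]
  set q := μ.real {ω | ∀ u ∈ (Finset.univ : Finset V), X u ω ≤ τ} with hq
  have hnone : MeasurableSet {ω | ∀ u ∈ (Finset.univ : Finset V), X u ω ≤ τ} := hXm (hset _)
  have hFi : ∀ v, Integrable (fun ω => F v fun v => X v ω) μ := by
    intro v
    refine (hXi v).mono ((hFm v).comp hXm).aestronglyMeasurable (ae_of_all _ fun ω => ?_)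
    simp only [hF]
    split_ifs <;> simp
  have hHb : ∀ v x, 0 ≤ H v x ∧ H v x ≤ 1 := by
    intro v x
    simp only [hH]
    split_ifs <;> simp
  have hHi : ∀ v, Integrable (fun ω => H v fun v => X v ω) μ := fun v =>
    Integrable.of_bound ((hHm v).comp hXm).aestronglyMeasurable 1 (ae_of_all _ fun ω => by
      rw [Real.norm_eq_abs, abs_of_nonneg (hHb v _).1]
      exact (hHb v _).2)
  have hF0 : ∀ v x, 0 ≤ F v x := by
    intro v x
    simp only [hF]
    split_ifs <;> linarith
  have hHq : ∀ v, q ≤ ∫ ω, H v (fun v => X v ω) ∂μ := by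
    intro v
    have hm : MeasurableSet {ω | ∀ u ∈ Finset.univ.erase v, X u ω ≤ τ} := hXm (hset _)
    simp only [hH]
    rw [integral_ite_one_zero hm, hq]
    exact measureReal_mono fun ω hω u _ => hω u (Finset.mem_univ u)
  have h1 : q * τ ≤ ∫ ω, M ω ∂μ := by
    calc q * τ ≤ q * ∑ v, ∫ ω, exceptionalPart X i v ω ∂μ :=
          mul_le_mul_of_nonneg_left hS measureReal_nonneg
      _ ≤ ∑ v, ∫ ω, F v (fun v => X v ω) * H v (fun v => X v ω) ∂μ := by
          rw [Finset.mul_sum]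
          refine Finset.sum_le_sum fun v _ => ?_
          have := (hind v).integral_fun_mul_eq_mul_integral (hFi v).aestronglyMeasurable
            (hHi v).aestronglyMeasurable
          rw [this, mul_comm]
          simp only [hexc]
          have hFv : ∀ ω, 0 ≤ F v fun v => X v ω := fun ω => hF0 v fun u => X u ω
          exact mul_le_mul_of_nonneg_left (hHq v) (integral_nonneg hFv)
      _ = ∫ ω, ∑ v, F v (fun v => X v ω) * H v (fun v => X v ω) ∂μ := by
          rw [integral_finsetSum]
          exact fun v _ => (hind v).integrable_mul (hFi v) (hHi v)
      _ ≤ ∫ ω, M ω ∂μ := by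
          refine integral_mono (integrable_finsetSum _ fun v _ =>
            (hind v).integrable_mul (hFi v) (hHi v)) hM fun ω => ?_
          by_cases hex : ∃ v, τ < X v ω ∧ ∀ u ∈ Finset.univ.erase v, X u ω ≤ τ
          · obtain ⟨v, hv, hu⟩ := hex
            dsimp only
            rw [Finset.sum_eq_single_of_mem v (Finset.mem_univ v)]
            · simp only [hF, hH, if_pos hv, if_pos hu, mul_one]
              exact hXM v ω
            · intro u _ huv
              have : ¬ τ < X u ω := not_lt.2 (hu u (by simp [huv]))
              simp [hF, this]
          · refine (Finset.sum_nonpos fun v _ => ?_).trans (hM0 ω)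
            by_cases hv : τ < X v ω
            · have : ¬ ∀ u ∈ Finset.univ.erase v, X u ω ≤ τ := fun hu => hex ⟨v, hv, hu⟩
              simp only [hH, if_neg this, mul_zero, le_refl]
            · simp [hF, hv]
  -- With probability `1 - q` some variable, hence `M`, exceeds `τ`. Adding this to `h1` eliminates
  -- `q`.
  have h2 : (1 - q) * τ ≤ ∫ ω, M ω ∂μ := by
    have hc := probReal_compl_eq_one_sub (μ := μ) hnone
    rw [← hq] at hc
    rw [← hc, ← integral_indicator_one hnone.compl, ← integral_mul_const]
    refine integral_mono ?_ hM fun ω => ?_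
    · exact ((integrable_indicator_iff hnone.compl).2 (integrable_const _).integrableOn).mul_const _
    · by_cases hω : ω ∈ {ω | ∀ u ∈ (Finset.univ : Finset V), X u ω ≤ τ}
      · rw [Set.indicator_of_notMem (Set.notMem_compl_iff.2 hω)]
        simpa using hM0 ω
      · rw [Set.indicator_of_mem hω]
        simp only [Finset.mem_univ, forall_const, Set.mem_ofPred_eq, not_forall, not_le] at hω
        obtain ⟨v, hv⟩ := hω
        simpa using hv.le.trans (hXM v ω)
  linarith

end Exceptional

/-! ### Exponential moments of sums of small independent variables. -/

section Exponential

variable {V Ω : Type*} {Y : V → Ω → ℝ}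

lemma rpow_le_rpow_sum {b θ : ℝ} (hb : 1 ≤ b) (hYθ : ∀ v ω, Y v ω ≤ θ) (s : Finset V) (ω : Ω) :
    b ^ (∑ v ∈ s, Y v ω) ≤ b ^ (s.card * θ) := by
  refine Real.rpow_le_rpow_of_exponent_le hb ?_
  have := Finset.sum_le_card_nsmul s (fun v => Y v ω) θ fun v _ => hYθ v ω
  rwa [nsmul_eq_mul] at this

variable [MeasurableSpace Ω] {μ : Measure Ω}

lemma prod_integral_rpow_eq (h : iIndepFun Y μ) (hY : ∀ v, Measurable (Y v)) {b : ℝ}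
    (hb : 0 < b) (s : Finset V) :
    ∏ v ∈ s, ∫ ω, b ^ Y v ω ∂μ = ∫ ω, b ^ (∑ v ∈ s, Y v ω) ∂μ := by
  rw [← integral_prod_comp_finset h hY (f := fun y => b ^ y) (measurable_id.const_pow b) s]
  simp only [Real.rpow_sum_of_pos hb]

variable [IsProbabilityMeasure μ]

lemma integrable_of_le_of_le {f : Ω → ℝ} (hf : Measurable f) {c : ℝ} (h0 : ∀ ω, 0 ≤ f ω)
    (hc : ∀ ω, f ω ≤ c) : Integrable f μ :=
  Integrable.of_bound hf.aestronglyMeasurable c (ae_of_all _ fun ω => by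
    rw [Real.norm_eq_abs, abs_of_nonneg (h0 ω)]
    exact hc ω)

lemma one_le_integral_rpow {b θ : ℝ} (hb : 1 ≤ b) {f : Ω → ℝ} (hf : Measurable f)
    (h0 : ∀ ω, 0 ≤ f ω) (hθ : ∀ ω, f ω ≤ θ) : 1 ≤ ∫ ω, b ^ f ω ∂μ := by
  have hb0 : 0 < b := by linarith
  have : ∫ _ω, (1 : ℝ) ∂μ ≤ ∫ ω, b ^ f ω ∂μ := by
    refine integral_mono (integrable_const _) (integrable_of_le_of_le (c := b ^ θ)
      (hf.const_pow b) (fun ω => by positivity)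
      fun ω => Real.rpow_le_rpow_of_exponent_le hb (hθ ω)) fun ω => ?_
    exact Real.one_le_rpow hb (h0 ω)
  simpa using this

lemma measurableSet_le_sum (hY : ∀ v, Measurable (Y v)) (θ : ℝ) (s : Finset V) :
    MeasurableSet {ω | θ ≤ ∑ v ∈ s, Y v ω} :=
  measurableSet_le measurable_const (Finset.measurable_fun_sum s fun v _ => hY v)

/-- The exponential moment of a sum of small independent variables, restricted to the event that
the sum is large. -/
lemma integral_rpow_sum_tail_le (h : iIndepFun Y μ) (hY : ∀ v, Measurable (Y v)) {b θ : ℝ}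
    (hb : 1 ≤ b) (hθ : 0 < θ) (hY0 : ∀ v ω, 0 ≤ Y v ω) (hYθ : ∀ v ω, Y v ω ≤ θ)
    (s : Finset V) :
    ∫ ω, (if θ ≤ ∑ v ∈ s, Y v ω then b ^ (∑ v ∈ s, Y v ω) else 0) ∂μ
      ≤ b ^ (2 * θ) * μ.real {ω | θ ≤ ∑ v ∈ s, Y v ω} * ∏ v ∈ s, ∫ ω, b ^ Y v ω ∂μ := by
  classical
  have hb0 : 0 < b := by linarith
  induction s using Finset.induction_on with
  | empty => simp [not_le.2 hθ]
  | insert u s hu ih =>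
    set Q := ∏ v ∈ s, ∫ ω, b ^ Y v ω ∂μ with hQ
    have hQ1 : 1 ≤ Q :=
      Finset.prod_induction _ (1 ≤ ·) (fun _ _ => one_le_mul_of_one_le_of_one_le) le_rfl
        fun v _ => one_le_integral_rpow hb (hY v) (hY0 v) (hYθ v)
    set E := ∫ ω, b ^ Y u ω ∂μ with hE
    have hE1 : 1 ≤ E := one_le_integral_rpow hb (hY u) (hY0 u) (hYθ u)
    set F : (V → ℝ) → ℝ := fun x => if θ ≤ ∑ v ∈ s, x v then b ^ (∑ v ∈ s, x v) else 0 with hF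
    have hsum : Measurable fun x : V → ℝ => ∑ v ∈ s, x v :=
      Finset.measurable_fun_sum s fun v _ => measurable_pi_apply v
    have hYm : Measurable fun ω v => Y v ω := measurable_pi_lambda _ hY
    have hFm : Measurable F :=
      Measurable.ite (measurableSet_le measurable_const hsum) (hsum.const_pow b) measurable_const
    have hH : Measurable fun x : V → ℝ => b ^ x u := (measurable_pi_apply u).const_pow b
    have hind := indepFun_of_dependsOn h hY (S := s) (T := {u}) (by simpa using hu) hFm hH
      (fun x y hxy => by
        have : ∑ v ∈ s, x v = ∑ v ∈ s, y v := Finset.sum_congr rfl fun v hv => hxy v hv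
        simp only [hF, this])
      (fun x y hxy => by simp only [hxy u (by simp)])
    have hFi : Integrable (fun ω => F fun v => Y v ω) μ := by
      refine integrable_of_le_of_le (c := b ^ (s.card * θ)) (hFm.comp hYm) (fun ω => ?_) fun ω => ?_
      · simp only [hF]
        split_ifs <;> positivity
      · simp only [hF]
        split_ifs
        · exact rpow_le_rpow_sum hb hYθ s ω
        · positivity
    have hHi : Integrable (fun ω => b ^ Y u ω) μ :=
      integrable_of_le_of_le (c := b ^ θ) ((hY u).const_pow b) (fun ω => by positivity)
        fun ω => Real.rpow_le_rpow_of_exponent_le hb (hYθ u ω)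
    have hprod := hind.integral_fun_mul_eq_mul_integral hFi.aestronglyMeasurable
      hHi.aestronglyMeasurable
    set p : Finset V → ℝ := fun s => μ.real {ω | θ ≤ ∑ v ∈ s, Y v ω} with hp
    have hpi : ∀ t : Finset V,
        Integrable (fun ω => if θ ≤ ∑ v ∈ t, Y v ω then (1 : ℝ) else 0) μ := fun t =>
      integrable_of_le_of_le (c := 1)
        (Measurable.ite (measurableSet_le_sum hY θ t) measurable_const measurable_const)
        (fun ω => by split_ifs <;> simp) (fun ω => by split_ifs <;> simp)
    have hpint : ∀ t : Finset V,
        ∫ ω, (if θ ≤ ∑ v ∈ t, Y v ω then (1 : ℝ) else 0) ∂μ = p t := fun t =>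
      integral_ite_one_zero (measurableSet_le_sum hY θ t)
    have hG : Integrable (fun ω => (F fun v => Y v ω) * b ^ Y u ω) μ :=
      hind.integrable_mul hFi hHi
    have hD : Integrable (fun ω => b ^ (2 * θ) *
        ((if θ ≤ ∑ v ∈ insert u s, Y v ω then (1 : ℝ) else 0) -
          if θ ≤ ∑ v ∈ s, Y v ω then (1 : ℝ) else 0)) μ :=
      ((hpi _).sub (hpi _)).const_mul _
    have hmono : p s ≤ p (insert u s) := by
      refine measureReal_mono fun ω hω => ?_
      simp only [Set.mem_ofPred_eq, Finset.sum_insert hu] at hω ⊢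
      linarith [hY0 u ω]
    -- Either the sum over `s` has already reached `θ`, and `Y u` contributes an independent factor,
    -- or `Y u` makes it cross `θ`; since `Y u ≤ θ`, the new sum is then at most `2 * θ`.
    calc ∫ ω, (if θ ≤ ∑ v ∈ insert u s, Y v ω then b ^ (∑ v ∈ insert u s, Y v ω) else 0) ∂μ
        ≤ ∫ ω, ((F fun v => Y v ω) * b ^ Y u ω + b ^ (2 * θ) *
            ((if θ ≤ ∑ v ∈ insert u s, Y v ω then (1 : ℝ) else 0) -
              if θ ≤ ∑ v ∈ s, Y v ω then (1 : ℝ) else 0)) ∂μ := by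
          refine integral_mono_of_nonneg (ae_of_all _ fun ω => ?_)
            (hG.add hD)
            (ae_of_all _ fun ω => ?_)
          · dsimp only [Pi.zero_apply]
            split_ifs <;> positivity
          · simp only [hF, Finset.sum_insert hu]
            have hyu := hY0 u ω
            have hyu' := hYθ u ω
            by_cases h1 : θ ≤ ∑ v ∈ s, Y v ω
            · have h2 : θ ≤ Y u ω + ∑ v ∈ s, Y v ω := by linarith
              simp only [if_pos h1, if_pos h2, sub_self, mul_zero, add_zero]
              rw [add_comm, Real.rpow_add hb0]
            · by_cases h2 : θ ≤ Y u ω + ∑ v ∈ s, Y v ω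
              · simp only [if_neg h1, if_pos h2, zero_mul, zero_add, sub_zero, mul_one]
                exact Real.rpow_le_rpow_of_exponent_le hb (by linarith)
              · simp [if_neg h1, if_neg h2]
      _ = (∫ ω, (F fun v => Y v ω) ∂μ) * E + b ^ (2 * θ) * (p (insert u s) - p s) := by
          rw [integral_add hG hD,
            hprod, integral_const_mul, integral_sub (hpi _) (hpi _), hpint, hpint]
      -- The crossing term is inflated by `E * Q ≥ 1` so that the two terms combine and `p s`
      -- cancels.
      _ ≤ (b ^ (2 * θ) * p s * Q) * E + b ^ (2 * θ) * (p (insert u s) - p s) * (E * Q) := by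
          refine add_le_add (mul_le_mul_of_nonneg_right ih (by linarith)) ?_
          have : 0 ≤ b ^ (2 * θ) * (p (insert u s) - p s) :=
            mul_nonneg (by positivity) (by linarith)
          exact le_mul_of_one_le_right this (by nlinarith)
      _ = b ^ (2 * θ) * p (insert u s) * ∏ v ∈ insert u s, ∫ ω, b ^ Y v ω ∂μ := by
          rw [Finset.prod_insert hu]
          ring

lemma integrable_rpow_sum (hY : ∀ v, Measurable (Y v)) {b θ : ℝ} (hb : 1 ≤ b)
    (hYθ : ∀ v ω, Y v ω ≤ θ) (s : Finset V) :
    Integrable (fun ω => b ^ (∑ v ∈ s, Y v ω)) μ :=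
  integrable_of_le_of_le (c := b ^ (s.card * θ))
    ((Finset.measurable_fun_sum s fun v _ => hY v).const_pow b)
    (fun ω => Real.rpow_nonneg (by linarith) _) (rpow_le_rpow_sum hb hYθ s)

/-- Exponential moments of a sum of small independent variables that is unlikely to be large. -/
lemma prod_integral_rpow_le (h : iIndepFun Y μ) (hY : ∀ v, Measurable (Y v)) {b θ : ℝ}
    (hb : 1 ≤ b) (hθ : 0 < θ) (hY0 : ∀ v ω, 0 ≤ Y v ω) (hYθ : ∀ v ω, Y v ω ≤ θ)
    (s : Finset V) (hp : b ^ (2 * θ) * μ.real {ω | θ ≤ ∑ v ∈ s, Y v ω} ≤ 1 / 2) :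
    ∏ v ∈ s, ∫ ω, b ^ Y v ω ∂μ ≤ 2 * b ^ θ := by
  have hb0 : 0 < b := by linarith
  have htail := integral_rpow_sum_tail_le h hY hb hθ hY0 hYθ s
  have hS := prod_integral_rpow_eq h hY hb0 s
  set Q := ∏ v ∈ s, ∫ ω, b ^ Y v ω ∂μ with hQ
  have hQ0 : 0 ≤ Q := Finset.prod_nonneg fun v _ => integral_nonneg fun ω => by positivity
  have hi : Integrable (fun ω => if θ ≤ ∑ v ∈ s, Y v ω then b ^ (∑ v ∈ s, Y v ω) else 0) μ := by
    refine (integrable_rpow_sum hY hb hYθ s).mono (Measurable.ite (measurableSet_le_sum hY θ s)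
      ((Finset.measurable_fun_sum s fun v _ => hY v).const_pow b)
      measurable_const).aestronglyMeasurable (ae_of_all _ fun ω => ?_)
    split_ifs <;> simp
  have : Q ≤ b ^ θ + ∫ ω, (if θ ≤ ∑ v ∈ s, Y v ω then b ^ (∑ v ∈ s, Y v ω) else 0) ∂μ := by
    rw [hS]
    calc ∫ ω, b ^ (∑ v ∈ s, Y v ω) ∂μ
        ≤ ∫ ω, (b ^ θ + if θ ≤ ∑ v ∈ s, Y v ω then b ^ (∑ v ∈ s, Y v ω) else 0) ∂μ := by
          refine integral_mono (integrable_rpow_sum hY hb hYθ s) ((integrable_const _).add hi)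
            fun ω => ?_
          dsimp only
          split_ifs with hc
          · have : 0 < b ^ θ := by positivity
            linarith
          · rw [add_zero]
            exact Real.rpow_le_rpow_of_exponent_le hb (by linarith)
      _ = _ := by
          rw [integral_add (integrable_const _) hi]
          simp
  -- The tail is at most `Q / 2`, which is absorbed into the left side.
  nlinarith

/-- This is `1 - exp (-x) ≤ x` at `x = y * log b`, multiplied by `exp x`. -/
lemma rpow_sub_one_le {b y : ℝ} (hb : 0 < b) : b ^ y - 1 ≤ y * Real.log b * b ^ y := by
  have h1 := Real.add_one_le_exp (-(Real.log b * y))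
  have h2 : Real.exp (-(Real.log b * y)) * Real.exp (Real.log b * y) = 1 := by
    rw [← Real.exp_add]; simp
  rw [Real.rpow_def_of_pos hb]
  nlinarith [Real.exp_pos (Real.log b * y)]

lemma half_le_log {b : ℝ} (hb : 2 ≤ b) : 1 / 2 ≤ Real.log b := by
  have := Real.log_le_log (by norm_num) hb
  linarith [Real.log_two_gt_d9]

/-- The total effective bandwidth of small independent variables, in terms of the probability that
their sum is large. -/
lemma sum_log_integral_rpow_le (h : iIndepFun Y μ) (hY : ∀ v, Measurable (Y v)) {b : ℝ}
    (hb : 2 ≤ b) (hY0 : ∀ v ω, 0 ≤ Y v ω) (hY1 : ∀ v ω, Y v ω ≤ 1 / 4)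
    (s : Finset V) (hp : μ.real {ω | 1 / 4 ≤ ∑ v ∈ s, Y v ω} ≤ 1 / 4) :
    ∑ v ∈ s, Real.log (∫ ω, b ^ Y v ω ∂μ) / Real.log b
      ≤ 5 / 4 + 16 * b * μ.real {ω | 1 / 4 ≤ ∑ v ∈ s, Y v ω} := by
  have hb0 : 0 < b := by linarith
  have hb1 : 1 ≤ b := by linarith
  have hlog := half_le_log hb
  have hlog0 : 0 < Real.log b := by linarith
  have hE1 : ∀ v, 1 ≤ ∫ ω, b ^ Y v ω ∂μ := fun v => one_le_integral_rpow hb1 (hY v) (hY0 v) (hY1 v)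
  rw [← Finset.sum_div, div_le_iff₀ hlog0]
  set p := μ.real {ω | 1 / 4 ≤ ∑ v ∈ s, Y v ω} with hpdef
  have hp0 : 0 ≤ p := measureReal_nonneg
  -- If `p` is small compared with `b ^ (-1/2)`, the moment bound applies in base `b` and gives the
  -- term 5/4. Otherwise it is applied in base 2, where `p ≤ 1/4` suffices, to bound the mean of the
  -- sum by 8; linearizing `b ^ y` then costs `8 * b ^ (1/4)`, which the lower bound on `p` turns
  -- into `16 * b * p`.
  by_cases hc : b ^ (2 * (1 / 4 : ℝ)) * p ≤ 1 / 2
  · have hQ := prod_integral_rpow_le h hY hb1 (by norm_num : (0 : ℝ) < 1 / 4) hY0 hY1 s hc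
    rw [← Real.log_prod fun v _ => by linarith [hE1 v]]
    have hlt := Real.log_le_log (Finset.prod_pos fun v _ => by linarith [hE1 v]) hQ
    rw [Real.log_mul (by norm_num) (by positivity), Real.log_rpow hb0] at hlt
    have := Real.log_le_log (by norm_num) hb
    nlinarith [mul_nonneg (mul_nonneg hb0.le hp0) hlog0.le]
  · have hQ := prod_integral_rpow_le h hY (by norm_num : (1 : ℝ) ≤ 2)
      (by norm_num : (0 : ℝ) < 1 / 4) hY0 hY1 s (by
        have : (2 : ℝ) ^ (2 * (1 / 4 : ℝ)) ≤ 2 ^ (1 : ℝ) :=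
          Real.rpow_le_rpow_of_exponent_le (by norm_num) (by norm_num)
        rw [Real.rpow_one] at this
        nlinarith)
    have h24 : (2 : ℝ) ^ (1 / 4 : ℝ) ≤ 2 ^ (1 : ℝ) :=
      Real.rpow_le_rpow_of_exponent_le (by norm_num) (by norm_num)
    rw [Real.rpow_one] at h24
    rw [prod_integral_rpow_eq h hY (by norm_num)] at hQ
    have hYi : ∀ v, Integrable (Y v) μ := fun v => integrable_of_le_of_le (hY v) (hY0 v) (hY1 v)
    have hES : ∫ ω, ∑ v ∈ s, Y v ω ∂μ ≤ 8 := by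
      calc ∫ ω, ∑ v ∈ s, Y v ω ∂μ ≤ ∫ ω, 2 * (2 : ℝ) ^ (∑ v ∈ s, Y v ω) ∂μ := by
            refine integral_mono (integrable_finsetSum _ fun v _ => hYi v)
              ((integrable_rpow_sum hY (by norm_num) hY1 s).const_mul 2) fun ω => ?_
            dsimp only
            rw [Real.rpow_def_of_pos (by norm_num)]
            have h1 := Real.add_one_le_exp (Real.log 2 * ∑ v ∈ s, Y v ω)
            have h2 : 0 ≤ ∑ v ∈ s, Y v ω := Finset.sum_nonneg fun v _ => hY0 v ω
            nlinarith [half_le_log (le_refl (2 : ℝ))]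
        _ ≤ 8 := by
            rw [integral_const_mul]
            linarith
    have hterm : ∀ v, Real.log (∫ ω, b ^ Y v ω ∂μ)
        ≤ Real.log b * b ^ (1 / 4 : ℝ) * ∫ ω, Y v ω ∂μ := by
      intro v
      have hi : Integrable (fun ω => b ^ Y v ω) μ :=
        integrable_of_le_of_le (c := b ^ (1 / 4 : ℝ)) ((hY v).const_pow b)
          (fun ω => by positivity) fun ω => Real.rpow_le_rpow_of_exponent_le hb1 (hY1 v ω)
      have h1 : Real.log (∫ ω, b ^ Y v ω ∂μ) ≤ (∫ ω, b ^ Y v ω ∂μ) - 1 :=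
        Real.log_le_sub_one_of_pos (by linarith [hE1 v])
      have h2 : (∫ ω, b ^ Y v ω ∂μ) - 1 = ∫ ω, (b ^ Y v ω - 1) ∂μ := by
        rw [integral_sub hi (integrable_const _)]
        simp
      rw [← integral_const_mul]
      rw [h2] at h1
      refine h1.trans (integral_mono (hi.sub (integrable_const _)) ((hYi v).const_mul _)
        fun ω => ?_)
      have h3 := rpow_sub_one_le (y := Y v ω) hb0
      have h4 : b ^ Y v ω ≤ b ^ (1 / 4 : ℝ) := Real.rpow_le_rpow_of_exponent_le hb1 (hY1 v ω)
      have h5 := mul_le_mul_of_nonneg_left h4 (mul_nonneg (hY0 v ω) hlog0.le)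
      dsimp only
      linarith
    have hsum : ∑ v ∈ s, Real.log (∫ ω, b ^ Y v ω ∂μ) ≤ Real.log b * b ^ (1 / 4 : ℝ) * 8 := by
      refine (Finset.sum_le_sum fun v _ => hterm v).trans ?_
      rw [← Finset.mul_sum, ← integral_finsetSum _ fun v _ => hYi v]
      exact mul_le_mul_of_nonneg_left hES (by positivity)
    have h6 : b ^ (1 / 4 : ℝ) ≤ 2 * b * p := by
      have h7 : b ^ (1 / 4 : ℝ) * b ^ (2 * (1 / 4 : ℝ)) ≤ b := by
        rw [← Real.rpow_add hb0]
        calc b ^ (1 / 4 + 2 * (1 / 4) : ℝ) ≤ b ^ (1 : ℝ) :=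
              Real.rpow_le_rpow_of_exponent_le hb1 (by norm_num)
          _ = b := Real.rpow_one b
      have h8 : 0 < b ^ (1 / 4 : ℝ) := by positivity
      push Not at hc
      nlinarith
    nlinarith [mul_le_mul_of_nonneg_left h6 hlog0.le]

end Exponential

/-! ### Truncations at a scale and bounds on the vertex weights. -/

section Weights

variable {V Ω : Type*} {X : V → Ω → ℝ}

lemma normalPart_div_nonneg (hX0 : ∀ v ω, 0 ≤ X v ω) (i : ℤ) (v : V) (ω : Ω) :
    0 ≤ normalPart X i v ω / (2 : ℝ) ^ i := by
  have := hX0 v ω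
  unfold normalPart
  split_ifs <;> positivity

lemma normalPart_div_le_one (i : ℤ) (v : V) (ω : Ω) :
    normalPart X i v ω / (2 : ℝ) ^ i ≤ 1 := by
  rw [div_le_one (by positivity)]
  unfold normalPart
  split_ifs with h
  exacts [h, by positivity]

lemma normalPart_add_exceptionalPart (i : ℤ) (v : V) (ω : Ω) :
    normalPart X i v ω + exceptionalPart X i v ω = X v ω := by
  unfold normalPart exceptionalPart
  by_cases h : X v ω ≤ (2 : ℝ) ^ i
  · simp [h, not_lt.2 h]
  · simp [h, not_le.1 h]

lemma exceptionalPart_nonneg (hX0 : ∀ v ω, 0 ≤ X v ω) (i : ℤ) (v : V) (ω : Ω) :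
    0 ≤ exceptionalPart X i v ω := by
  have := hX0 v ω
  unfold exceptionalPart
  split_ifs <;> linarith

lemma exceptionalPart_le (hX0 : ∀ v ω, 0 ≤ X v ω) (i : ℤ) (v : V) (ω : Ω) :
    exceptionalPart X i v ω ≤ X v ω := by
  have := hX0 v ω
  unfold exceptionalPart
  split_ifs <;> linarith

/-- The variable `X_v / 2^i`, truncated at `1 / 4`. -/
noncomputable def smallPart (X : V → Ω → ℝ) (i : ℤ) (v : V) (ω : Ω) : ℝ :=
  if X v ω ≤ (2 : ℝ) ^ i / 4 then X v ω / (2 : ℝ) ^ i else 0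

lemma smallPart_nonneg (hX0 : ∀ v ω, 0 ≤ X v ω) (i : ℤ) (v : V) (ω : Ω) :
    0 ≤ smallPart X i v ω := by
  have := hX0 v ω
  unfold smallPart
  split_ifs <;> positivity

lemma smallPart_le (i : ℤ) (v : V) (ω : Ω) : smallPart X i v ω ≤ 1 / 4 := by
  unfold smallPart
  split_ifs with h
  · rw [div_le_iff₀ (by positivity)]
    linarith
  · norm_num

lemma smallPart_le_div (hX0 : ∀ v ω, 0 ≤ X v ω) (i : ℤ) (v : V) (ω : Ω) :
    smallPart X i v ω ≤ X v ω / (2 : ℝ) ^ i := by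
  have := hX0 v ω
  unfold smallPart
  split_ifs with h
  · exact le_rfl
  · positivity

variable [MeasurableSpace Ω]

lemma measurable_normalPart (hX : ∀ v, Measurable (X v)) (i : ℤ) (v : V) :
    Measurable (normalPart X i v) :=
  Measurable.ite (measurableSet_le (hX v) measurable_const) (hX v) measurable_const

lemma measurable_exceptionalPart (hX : ∀ v, Measurable (X v)) (i : ℤ) (v : V) :
    Measurable (exceptionalPart X i v) :=
  Measurable.ite (measurableSet_lt measurable_const (hX v)) (hX v) measurable_const

variable {μ : Measure Ω}

lemma integrable_exceptionalPart (hX : ∀ v, Measurable (X v)) (hX0 : ∀ v ω, 0 ≤ X v ω)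
    (hXi : ∀ v, Integrable (X v) μ) (i : ℤ) (v : V) : Integrable (exceptionalPart X i v) μ :=
  (hXi v).mono (measurable_exceptionalPart hX i v).aestronglyMeasurable (ae_of_all _ fun ω => by
    rw [Real.norm_eq_abs, Real.norm_eq_abs, abs_of_nonneg (exceptionalPart_nonneg hX0 i v ω),
      abs_of_nonneg (hX0 v ω)]
    exact exceptionalPart_le hX0 i v ω)

lemma sum_integral_exceptionalPart_div [Fintype V] (i : ℤ) :
    ∑ v, ∫ ω, exceptionalPart X i v ω / (2 : ℝ) ^ i ∂μ
      = (∑ v, ∫ ω, exceptionalPart X i v ω ∂μ) / (2 : ℝ) ^ i := by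
  simp only [integral_div, Finset.sum_div]

lemma measurable_smallPart (hX : ∀ v, Measurable (X v)) (i : ℤ) (v : V) :
    Measurable (smallPart X i v) :=
  Measurable.ite (measurableSet_le (hX v) measurable_const) ((hX v).div_const _) measurable_const

lemma iIndepFun_smallPart (h : iIndepFun X μ) (i : ℤ) : iIndepFun (smallPart X i) μ :=
  h.comp (fun _ x => if x ≤ (2 : ℝ) ^ i / 4 then x / (2 : ℝ) ^ i else 0) fun _ =>
    Measurable.ite (measurableSet_le measurable_id measurable_const) (measurable_id.div_const _)
      measurable_const

lemma iIndepFun_normalPart_div (h : iIndepFun X μ) (i : ℤ) :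
    iIndepFun (fun v ω => normalPart X i v ω / (2 : ℝ) ^ i) μ := by
  classical
  have := h.comp (fun _ x => (if x ≤ (2 : ℝ) ^ i then x else 0) / (2 : ℝ) ^ i) fun _ =>
    (Measurable.ite (measurableSet_le measurable_id measurable_const) measurable_id
      measurable_const).div_const _
  convert this using 2 with v
  ext ω
  simp [normalPart]

variable [IsProbabilityMeasure μ]

lemma vertexWeight_nonneg (hX : ∀ v, Measurable (X v)) (hX0 : ∀ v ω, 0 ≤ X v ω) {k : ℕ}
    (hk : 1 ≤ k) (i : ℤ) (v : V) : 0 ≤ vertexWeight μ X k i v := by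
  have hk1 : (1 : ℝ) ≤ k := by exact_mod_cast hk
  exact div_nonneg (Real.log_nonneg (one_le_integral_rpow hk1
    ((measurable_normalPart hX i v).div_const _) (normalPart_div_nonneg hX0 i v)
    (normalPart_div_le_one i v))) (Real.log_nonneg hk1)

lemma vertexWeight_le_one (hX : ∀ v, Measurable (X v)) (hX0 : ∀ v ω, 0 ≤ X v ω) {k : ℕ}
    (hk : 1 ≤ k) (i : ℤ) (v : V) : vertexWeight μ X k i v ≤ 1 := by
  have hk1 : (1 : ℝ) ≤ k := by exact_mod_cast hk
  have hm := (measurable_normalPart hX i v).div_const ((2 : ℝ) ^ i)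
  have h1 := one_le_integral_rpow (μ := μ) hk1 hm (normalPart_div_nonneg hX0 i v)
    (normalPart_div_le_one i v)
  refine div_le_one_of_le₀ (Real.log_le_log (by linarith) ?_) (Real.log_nonneg hk1)
  have hle : ∀ ω, (k : ℝ) ^ (normalPart X i v ω / (2 : ℝ) ^ i) ≤ k := fun ω => by
    simpa using Real.rpow_le_rpow_of_exponent_le hk1 (normalPart_div_le_one i v ω)
  have := integral_mono (integrable_of_le_of_le (μ := μ) (hm.const_pow (k : ℝ))
    (fun ω => Real.rpow_nonneg (by linarith) _) hle) (integrable_const (k : ℝ)) hle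
  simpa using this

/-- The weight of a vertex is controlled by its small part and the probability that it is large. -/
lemma vertexWeight_le (hX : ∀ v, Measurable (X v)) (hX0 : ∀ v ω, 0 ≤ X v ω) {k : ℕ}
    (hk : 2 ≤ k) (i : ℤ) (v : V) :
    vertexWeight μ X k i v ≤ Real.log (∫ ω, (k : ℝ) ^ smallPart X i v ω ∂μ) / Real.log k
      + 2 * k * μ.real {ω | ¬ X v ω ≤ (2 : ℝ) ^ i / 4} := by
  have hk2 : (2 : ℝ) ≤ k := by exact_mod_cast hk
  have hk1 : (1 : ℝ) ≤ k := by linarith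
  have hk0 : (0 : ℝ) < k := by linarith
  have hlog := half_le_log hk2
  have hm := (measurable_normalPart hX i v).div_const ((2 : ℝ) ^ i)
  have h1 := one_le_integral_rpow (μ := μ) hk1 hm (normalPart_div_nonneg hX0 i v)
    (normalPart_div_le_one i v)
  have h2 := one_le_integral_rpow (μ := μ) hk1 (measurable_smallPart hX i v)
    (smallPart_nonneg hX0 i v) (smallPart_le i v)
  have hset : MeasurableSet {ω | ¬ X v ω ≤ (2 : ℝ) ^ i / 4} :=
    (measurableSet_le (hX v) measurable_const).compl
  set p := μ.real {ω | ¬ X v ω ≤ (2 : ℝ) ^ i / 4} with hp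
  have hp0 : 0 ≤ p := measureReal_nonneg
  have hsi : Integrable (fun ω => (k : ℝ) ^ smallPart X i v ω) μ :=
    integrable_of_le_of_le (c := (k : ℝ) ^ (1 / 4 : ℝ)) ((measurable_smallPart hX i v).const_pow _)
      (fun ω => by positivity) fun ω => Real.rpow_le_rpow_of_exponent_le hk1 (smallPart_le i v ω)
  have hii : Integrable (fun ω => if ¬ X v ω ≤ (2 : ℝ) ^ i / 4 then (1 : ℝ) else 0) μ :=
    integrable_of_le_of_le (c := 1) (Measurable.ite hset measurable_const measurable_const)
      (fun ω => by split_ifs <;> simp) (fun ω => by split_ifs <;> simp)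
  have hni : Integrable (fun ω => (k : ℝ) ^ (normalPart X i v ω / (2 : ℝ) ^ i)) μ :=
    integrable_of_le_of_le (c := (k : ℝ) ^ (1 : ℝ)) (hm.const_pow _)
      (fun ω => by positivity)
      fun ω => Real.rpow_le_rpow_of_exponent_le hk1 (normalPart_div_le_one i v ω)
  -- Off the large event normal and small parts agree; on it the normalized exponent is at most 1,
  -- so the integrand is at most `k`.
  have h3 : ∫ ω, (k : ℝ) ^ (normalPart X i v ω / (2 : ℝ) ^ i) ∂μ
      ≤ (∫ ω, (k : ℝ) ^ smallPart X i v ω ∂μ) + k * p := by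
    rw [hp, ← integral_ite_one_zero hset, ← integral_const_mul,
      ← integral_add hsi (hii.const_mul _)]
    refine integral_mono hni (hsi.add (hii.const_mul _)) fun ω => ?_
    dsimp only
    by_cases hc : X v ω ≤ (2 : ℝ) ^ i / 4
    · have h4 : X v ω ≤ (2 : ℝ) ^ i := hc.trans (by
        have : (0 : ℝ) < 2 ^ i := by positivity
        linarith)
      simp [normalPart, smallPart, hc, h4]
    · have h4 := Real.rpow_le_rpow_of_exponent_le hk1 (normalPart_div_le_one (X := X) i v ω)
      rw [Real.rpow_one] at h4
      have h5 : (0 : ℝ) < (k : ℝ) ^ smallPart X i v ω := by positivity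
      rw [if_pos hc]
      linarith
  set a := ∫ ω, (k : ℝ) ^ smallPart X i v ω ∂μ
  unfold vertexWeight effectiveBandwidth
  rw [div_le_iff₀ (by linarith), add_mul, div_mul_cancel₀ _ (by linarith)]
  -- As `a ≥ 1`, `a + k * p ≤ a * (1 + k * p)`, which separates the logarithm. The factor 2 in the
  -- conclusion comes from `log k ≥ 1/2`.
  have h4 : Real.log (∫ ω, (k : ℝ) ^ (normalPart X i v ω / (2 : ℝ) ^ i) ∂μ)
      ≤ Real.log (a * (1 + k * p)) :=
    Real.log_le_log (by linarith) (h3.trans (by nlinarith [mul_nonneg hk0.le hp0]))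
  rw [Real.log_mul (by linarith) (by positivity)] at h4
  have h5 : Real.log (1 + k * p) ≤ (1 + k * p) - 1 :=
    Real.log_le_sub_one_of_pos (by positivity)
  nlinarith [mul_nonneg hk0.le hp0]

end Weights

/-! ### Cost of a partition against effective bandwidth. -/

section Partition

variable {V Ω : Type*} [Fintype V] [DecidableEq V] {X : V → Ω → ℝ}

lemma sum_le_iSup_parts (X : V → Ω → ℝ) (P : Finpartition (Finset.univ : Finset V)) {B : Finset V}
    (hB : B ∈ P.parts) (ω : Ω) :
    ∑ v ∈ B, X v ω ≤ ⨆ B : P.parts, ∑ v ∈ (B : Finset V), X v ω :=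
  le_ciSup (f := fun B : P.parts => ∑ v ∈ (B : Finset V), X v ω) (Set.finite_range _).bddAbove
    ⟨B, hB⟩

lemma le_iSup_parts (hX0 : ∀ v ω, 0 ≤ X v ω) (P : Finpartition (Finset.univ : Finset V)) (v : V)
    (ω : Ω) : X v ω ≤ ⨆ B : P.parts, ∑ v ∈ (B : Finset V), X v ω := by
  obtain ⟨B, hB, hv⟩ := P.exists_mem (Finset.mem_univ v)
  exact (Finset.single_le_sum (f := fun v => X v ω) (fun u _ => hX0 u ω) hv).trans
    (sum_le_iSup_parts X P hB ω)

lemma iSup_parts_nonneg (hX0 : ∀ v ω, 0 ≤ X v ω) (P : Finpartition (Finset.univ : Finset V))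
    (ω : Ω) : 0 ≤ ⨆ B : P.parts, ∑ v ∈ (B : Finset V), X v ω :=
  Real.iSup_nonneg fun _ => Finset.sum_nonneg fun v _ => hX0 v ω

variable [MeasurableSpace Ω] {μ : Measure Ω}

lemma integrable_iSup_parts (hX : ∀ v, Measurable (X v)) (hX0 : ∀ v ω, 0 ≤ X v ω)
    (hXi : ∀ v, Integrable (X v) μ) (P : Finpartition (Finset.univ : Finset V)) :
    Integrable (fun ω => ⨆ B : P.parts, ∑ v ∈ (B : Finset V), X v ω) μ := by
  refine (integrable_finsetSum Finset.univ fun v _ => hXi v).mono (Measurable.iSup fun B =>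
    Finset.measurable_fun_sum _ fun v _ => hX v).aestronglyMeasurable (ae_of_all _ fun ω => ?_)
  rw [Real.norm_eq_abs, Real.norm_eq_abs, abs_of_nonneg (iSup_parts_nonneg hX0 P ω),
    abs_of_nonneg (Finset.sum_nonneg fun v _ => hX0 v ω)]
  exact Real.iSup_le (fun B => Finset.sum_le_sum_of_subset_of_nonneg (Finset.subset_univ _)
    fun v _ _ => hX0 v ω) (Finset.sum_nonneg fun v _ => hX0 v ω)

lemma sum_parts (P : Finpartition (Finset.univ : Finset V)) (f : V → ℝ) :
    ∑ v, f v = ∑ B ∈ P.parts, ∑ v ∈ B, f v := by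
  have h := Finset.sum_biUnion (f := f) (s := P.parts) (t := id) P.disjoint
  rwa [P.biUnion_parts] at h

variable [IsProbabilityMeasure μ]

/-- The lower bound of Kleinberg, Rabani and Tardos: a partition of small cost forces the total
effective bandwidth to be small. -/
lemma sum_vertexWeight_le (h : iIndepFun X μ) (hX : ∀ v, Measurable (X v))
    (hX0 : ∀ v ω, 0 ≤ X v ω) (hXi : ∀ v, Integrable (X v) μ)
    (P : Finpartition (Finset.univ : Finset V)) {i : ℤ}
    (hP : expectedMax μ X P ≤ (2 : ℝ) ^ i / 16) :
    ∑ v, vertexWeight μ X P.parts.card i v ≤ 17 * P.parts.card := by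
  classical
  -- For fewer than two parts `log k` is 0, so division by zero makes all weights vanish.
  rcases Nat.lt_or_ge P.parts.card 2 with hk | hk
  · have hz : ∀ v, vertexWeight μ X P.parts.card i v = 0 := by
      intro v
      interval_cases P.parts.card <;> simp [vertexWeight, effectiveBandwidth]
    simp only [hz, Finset.sum_const_zero]
    positivity
  set k := P.parts.card with hkdef
  have hk2 : (2 : ℝ) ≤ k := by exact_mod_cast hk
  have hτ : (0 : ℝ) < 2 ^ i := by positivity
  set M : Ω → ℝ := fun ω => ⨆ B : P.parts, ∑ v ∈ (B : Finset V), X v ω with hM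
  -- Markov's inequality; the 16 in the hypothesis is chosen for this.
  have hMk : μ.real {ω | (2 : ℝ) ^ i / 4 ≤ M ω} ≤ 1 / 4 := by
    have h1 := mul_meas_ge_le_integral_of_nonneg (ae_of_all μ (iSup_parts_nonneg hX0 P))
      (integrable_iSup_parts hX hX0 hXi P) ((2 : ℝ) ^ i / 4)
    have h2 : (2 : ℝ) ^ i / 4 * μ.real {ω | (2 : ℝ) ^ i / 4 ≤ M ω} ≤ (2 : ℝ) ^ i / 16 := h1.trans hP
    by_contra hc
    nlinarith
  set Y := smallPart X i with hY
  have hYm : ∀ v, Measurable (Y v) := measurable_smallPart hX i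
  have hYind : iIndepFun Y μ := iIndepFun_smallPart h i
  have hpart : ∀ B ∈ P.parts, ∀ ω, 1 / 4 ≤ ∑ v ∈ B, Y v ω → (2 : ℝ) ^ i / 4 ≤ M ω := by
    intro B hB ω hω
    refine le_trans ?_ (sum_le_iSup_parts X P hB ω)
    have h1 : ∑ v ∈ B, Y v ω ≤ (∑ v ∈ B, X v ω) / (2 : ℝ) ^ i := by
      rw [Finset.sum_div]
      exact Finset.sum_le_sum fun v _ => smallPart_le_div hX0 i v ω
    have h2 := hω.trans h1
    rw [le_div_iff₀ hτ] at h2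
    linarith
  have hsmall : ∑ B ∈ P.parts, μ.real {ω | 1 / 4 ≤ ∑ v ∈ B, Y v ω} ≤ 1 / 3 := by
    have := sum_measureReal_le_third hYind hYm P.parts id P.disjoint
      (fun B y => ¬ 1 / 4 ≤ ∑ v ∈ B, y v)
      (fun B => by
        rw [← measurableSet_setOfPred]
        exact (measurableSet_le measurable_const
          (Finset.measurable_fun_sum B fun v _ => measurable_pi_apply v)).compl)
      (fun B x y hxy => by
        have : ∑ v ∈ B, x v = ∑ v ∈ B, y v := Finset.sum_congr rfl fun v hv => hxy v hv
        simp only [this])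
      ((measureReal_mono fun ω hω => by
        obtain ⟨B, hB, hω⟩ := hω
        exact hpart B hB ω (not_not.1 hω)).trans hMk)
    simpa only [not_not] using this
  have hlarge : ∑ v, μ.real {ω | ¬ X v ω ≤ (2 : ℝ) ^ i / 4} ≤ 1 / 3 := by
    refine sum_measureReal_le_third h hX Finset.univ (fun v => {v})
      (fun u _ v _ huv => Finset.disjoint_singleton.2 huv)
      (fun v x => x v ≤ (2 : ℝ) ^ i / 4)
      (fun v => by
        rw [← measurableSet_setOfPred]
        exact measurableSet_le (measurable_pi_apply v) measurable_const)
      (fun v x y hxy => by simp only [hxy v (by simp)])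
      ((measureReal_mono fun ω hω => ?_).trans hMk)
    obtain ⟨v, -, hv⟩ := hω
    exact (not_le.1 hv).le.trans (le_iSup_parts hX0 P v ω)
  have hB : ∀ B ∈ P.parts,
      ∑ v ∈ B, Real.log (∫ ω, (k : ℝ) ^ Y v ω ∂μ) / Real.log k
        ≤ 5 / 4 + 16 * k * μ.real {ω | 1 / 4 ≤ ∑ v ∈ B, Y v ω} := fun B hB =>
    sum_log_integral_rpow_le hYind hYm hk2 (smallPart_nonneg hX0 i) (smallPart_le i) B
      ((measureReal_mono fun ω hω => hpart B hB ω hω).trans hMk)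
  calc ∑ v, vertexWeight μ X k i v
      ≤ ∑ v, (Real.log (∫ ω, (k : ℝ) ^ Y v ω ∂μ) / Real.log k
          + 2 * k * μ.real {ω | ¬ X v ω ≤ (2 : ℝ) ^ i / 4}) :=
        Finset.sum_le_sum fun v _ => vertexWeight_le hX hX0 hk i v
    _ = (∑ B ∈ P.parts, ∑ v ∈ B, Real.log (∫ ω, (k : ℝ) ^ Y v ω ∂μ) / Real.log k)
          + 2 * k * ∑ v, μ.real {ω | ¬ X v ω ≤ (2 : ℝ) ^ i / 4} := by
        rw [Finset.sum_add_distrib, ← Finset.mul_sum, ← sum_parts]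
    _ ≤ (∑ B ∈ P.parts, (5 / 4 + 16 * k * μ.real {ω | 1 / 4 ≤ ∑ v ∈ B, Y v ω}))
          + 2 * k * (1 / 3) :=
        add_le_add (Finset.sum_le_sum hB) (mul_le_mul_of_nonneg_left hlarge (by positivity))
    _ ≤ 17 * k := by
        rw [Finset.sum_add_distrib, ← Finset.mul_sum, Finset.sum_const, nsmul_eq_mul, ← hkdef]
        -- The total per part is 5/4 + 16/3 + 2/3, below 17.
        nlinarith

/-- The upper bound: parts of bounded effective bandwidth have a maximum of bounded expectation. -/
lemma expectedMax_le (h : iIndepFun X μ) (hX : ∀ v, Measurable (X v))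
    (hX0 : ∀ v ω, 0 ≤ X v ω) (hXi : ∀ v, Integrable (X v) μ)
    (P : Finpartition (Finset.univ : Finset V)) {i : ℤ} (hk : 2 ≤ P.parts.card)
    (hw : ∀ B ∈ P.parts, ∑ v ∈ B, vertexWeight μ X P.parts.card i v ≤ 18)
    (hS : ∑ v, ∫ ω, exceptionalPart X i v ω / (2 : ℝ) ^ i ∂μ ≤ 1) :
    expectedMax μ X P ≤ 22 * (2 : ℝ) ^ i := by
  set k := P.parts.card with hkdef
  have hk2 : (2 : ℝ) ≤ k := by exact_mod_cast hk
  have hk1 : (1 : ℝ) ≤ k := by linarith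
  have hk0 : (0 : ℝ) < k := by linarith
  have hlog := half_le_log hk2
  have hτ : (0 : ℝ) < 2 ^ i := by positivity
  set Y : V → Ω → ℝ := fun v ω => normalPart X i v ω / (2 : ℝ) ^ i with hY
  have hYm : ∀ v, Measurable (Y v) := fun v => (measurable_normalPart hX i v).div_const _
  have hYind : iIndepFun Y μ := iIndepFun_normalPart_div h i
  have hY0 : ∀ v ω, 0 ≤ Y v ω := normalPart_div_nonneg hX0 i
  have hY1 : ∀ v ω, Y v ω ≤ 1 := normalPart_div_le_one i
  have hE1 : ∀ v, 1 ≤ ∫ ω, (k : ℝ) ^ Y v ω ∂μ := fun v =>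
    one_le_integral_rpow hk1 (hYm v) (hY0 v) (hY1 v)
  have hexp : ∀ B ∈ P.parts, ∫ ω, (k : ℝ) ^ (∑ v ∈ B, Y v ω) ∂μ ≤ (k : ℝ) ^ (18 : ℝ) := by
    intro B hB
    rw [← prod_integral_rpow_eq hYind hYm hk0]
    have h1 : ∑ v ∈ B, Real.log (∫ ω, (k : ℝ) ^ Y v ω ∂μ) ≤ 18 * Real.log k := by
      have := hw B hB
      simp only [vertexWeight, effectiveBandwidth] at this
      rwa [← Finset.sum_div, div_le_iff₀ (by linarith)] at this
    rw [← Real.log_prod fun v _ => by linarith [hE1 v], ← Real.log_rpow hk0] at h1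
    exact (Real.log_le_log_iff (Finset.prod_pos fun v _ => by linarith [hE1 v])
      (by positivity)).1 h1
  have hexpi : ∀ B : Finset V, Integrable (fun ω => (k : ℝ) ^ (∑ v ∈ B, Y v ω)) μ := fun B =>
    integrable_rpow_sum hYm hk1 hY1 B
  have hSi := integrable_exceptionalPart hX hX0 hXi i
  rw [sum_integral_exceptionalPart_div, div_le_one hτ] at hS
  -- Replaces the maximum over parts by a sum of exponentials. With moments at most `k ^ 18`,
  -- dividing by `k ^ 19` leaves `1 / k` per part, so the sum over `k` parts adds 2 to the 19; the
  -- exceptional parts add 1 more.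
  have hy : ∀ y : ℝ, y ≤ 19 + 2 * ((k : ℝ) ^ y / (k : ℝ) ^ (19 : ℝ)) := by
    intro y
    rw [← Real.rpow_sub hk0]
    have h1 : (0 : ℝ) < (k : ℝ) ^ (y - 19) := by positivity
    rcases le_total y 19 with hle | hge
    · linarith
    · have h2 := Real.add_one_le_exp (Real.log k * (y - 19))
      rw [Real.rpow_def_of_pos hk0]
      nlinarith
  have hi1 : Integrable (fun ω => ∑ B ∈ P.parts,
      (k : ℝ) ^ (∑ v ∈ B, Y v ω) / (k : ℝ) ^ (19 : ℝ)) μ :=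
    integrable_finsetSum _ fun B _ => (hexpi B).div_const _
  have hi2 : Integrable (fun ω => (2 : ℝ) ^ i * (19 + 2 * ∑ B ∈ P.parts,
      (k : ℝ) ^ (∑ v ∈ B, Y v ω) / (k : ℝ) ^ (19 : ℝ))) μ :=
    ((integrable_const _).add (hi1.const_mul _)).const_mul _
  have hi3 : Integrable (fun ω => ∑ v, exceptionalPart X i v ω) μ :=
    integrable_finsetSum _ fun v _ => hSi v
  calc expectedMax μ X P
      ≤ ∫ ω, ((2 : ℝ) ^ i * (19 + 2 * ∑ B ∈ P.parts,
          (k : ℝ) ^ (∑ v ∈ B, Y v ω) / (k : ℝ) ^ (19 : ℝ))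
          + ∑ v, exceptionalPart X i v ω) ∂μ := by
        refine integral_mono (integrable_iSup_parts hX hX0 hXi P) (hi2.add hi3) fun ω => ?_
        have hS0 : 0 ≤ ∑ v, exceptionalPart X i v ω :=
          Finset.sum_nonneg fun v _ => exceptionalPart_nonneg hX0 i v ω
        refine Real.iSup_le (fun B => ?_) (by positivity)
        have h1 : ∑ v ∈ (B : Finset V), X v ω = (2 : ℝ) ^ i * ∑ v ∈ (B : Finset V), Y v ω
            + ∑ v ∈ (B : Finset V), exceptionalPart X i v ω := by
          rw [Finset.mul_sum, ← Finset.sum_add_distrib]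
          refine Finset.sum_congr rfl fun v _ => ?_
          rw [mul_div_cancel₀ _ hτ.ne', normalPart_add_exceptionalPart]
        have h2 : ∑ v ∈ (B : Finset V), exceptionalPart X i v ω
            ≤ ∑ v, exceptionalPart X i v ω :=
          Finset.sum_le_sum_of_subset_of_nonneg (Finset.subset_univ _)
            fun v _ _ => exceptionalPart_nonneg hX0 i v ω
        have h3 := Finset.single_le_sum
          (f := fun B : Finset V => (k : ℝ) ^ (∑ v ∈ B, Y v ω) / (k : ℝ) ^ (19 : ℝ))
          (fun B _ => by positivity) B.2
        have h4 := hy (∑ v ∈ (B : Finset V), Y v ω)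
        rw [h1]
        refine add_le_add (mul_le_mul_of_nonneg_left ?_ hτ.le) h2
        linarith
    _ = (2 : ℝ) ^ i * (19 + 2 * ∑ B ∈ P.parts,
          (∫ ω, (k : ℝ) ^ (∑ v ∈ B, Y v ω) ∂μ) / (k : ℝ) ^ (19 : ℝ))
          + ∑ v, ∫ ω, exceptionalPart X i v ω ∂μ := by
        rw [integral_add hi2 hi3, integral_const_mul,
          integral_add (integrable_const _) (hi1.const_mul _), integral_const_mul,
          integral_finsetSum _ fun B _ => (hexpi B).div_const _,
          integral_finsetSum _ fun v _ => hSi v]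
        simp [integral_div]
    _ ≤ (2 : ℝ) ^ i * (19 + 2 * ∑ B ∈ P.parts, (1 : ℝ) / k) + (2 : ℝ) ^ i := by
        have h18 : (k : ℝ) ^ (19 : ℝ) = (k : ℝ) ^ (18 : ℝ) * k := by
          rw [show (19 : ℝ) = 18 + 1 by norm_num, Real.rpow_add hk0, Real.rpow_one]
        have hsum : ∑ B ∈ P.parts, (∫ ω, (k : ℝ) ^ (∑ v ∈ B, Y v ω) ∂μ) / (k : ℝ) ^ (19 : ℝ)
            ≤ ∑ B ∈ P.parts, (1 : ℝ) / k := by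
          refine Finset.sum_le_sum fun B hB => ?_
          rw [h18, div_le_div_iff₀ (by positivity) hk0, one_mul]
          exact mul_le_mul_of_nonneg_right (hexp B hB) hk0.le
        have := mul_le_mul_of_nonneg_left hsum hτ.le
        linarith
    _ = 22 * (2 : ℝ) ^ i := by
        rw [Finset.sum_const, nsmul_eq_mul, ← hkdef, mul_one_div_cancel hk0.ne']
        ring

end Partition

/-! ### Accepted and rejected scales, and the output of Stochastic Partition. -/

section Algorithm

variable {V Ω : Type*} [Fintype V] [DecidableEq V] [MeasurableSpace Ω] {μ : Measure Ω}
  {G : SimpleGraph V} {ord : Fin (Fintype.card V) ≃ V} {τ : TieBreak} {k : ℕ} {X : V → Ω → ℝ}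

/-- Zero weights impose no constraint, so Dynamic Partition itself supplies a partition. -/
lemma exists_finpartition_card (ord : Fin (Fintype.card V) ≃ V) (hk : 1 ≤ k)
    (hkn : k ≤ Fintype.card V) : ∃ P : Finpartition (Finset.univ : Finset V), P.parts.card = k := by
  obtain ⟨P, -, hP, -⟩ := exists_finpartition_of_dynamicPartition ⊥ ord
    ⟨fun _ _ S => if h : S.Nonempty then h.choose else 0, fun _ _ S h => by
      rw [dif_pos h]
      exact h.choose_spec⟩ k (fun _ => 0) 0
    (dynamicPartition_ne_none ⊥ ord _ hk hkn (m := 0) le_rfl (fun _ => le_rfl) (by simp)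
      fun _ => le_rfl)
  exact ⟨P, hP⟩

lemma le_optS {c : ℝ} (P : Finpartition (Finset.univ : Finset V)) (hP : P.parts.card = k)
    (h : ∀ Q : Finpartition (Finset.univ : Finset V), Q.parts.card = k → c ≤ expectedMax μ X Q) :
    c ≤ optS μ X k :=
  -- Needed because a real infimum over an empty family is 0 by default.
  haveI : Nonempty {P : Finpartition (Finset.univ : Finset V) // P.parts.card = k} := ⟨⟨P, hP⟩⟩
  le_ciInf fun Q => h Q.1 Q.2

lemma eq_of_card_parts_eq_one {P Q : Finpartition (Finset.univ : Finset V)}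
    (hP : P.parts.card = 1) (hQ : Q.parts.card = 1) : P = Q := by
  have key : ∀ R : Finpartition (Finset.univ : Finset V), R.parts.card = 1 →
      R.parts = {Finset.univ} := by
    intro R hR
    obtain ⟨B, hB⟩ := Finset.card_eq_one.1 hR
    have := R.sup_parts
    rw [hB, Finset.sup_singleton, id] at this
    rw [hB, this]
  exact Finpartition.ext ((key P hP).trans (key Q hQ).symm)

variable [IsProbabilityMeasure μ]

/-- At a scale well above the cost of some partition, the stopping condition holds. -/
lemma scaleAccepted_of_expectedMax_lt (h : iIndepFun X μ) (hX : ∀ v, Measurable (X v))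
    (hX0 : ∀ v ω, 0 ≤ X v ω) (hXi : ∀ v, Integrable (X v) μ) (hk : 1 ≤ k)
    (hkn : k ≤ Fintype.card V) {i : ℤ} (Q : Finpartition (Finset.univ : Finset V))
    (hQ : Q.parts.card = k) (hlt : 16 * expectedMax μ X Q < (2 : ℝ) ^ i) :
    ScaleAccepted G ord τ μ X k i := by
  have hτ : (0 : ℝ) < 2 ^ i := by positivity
  have hk0 : (0 : ℝ) < k := by exact_mod_cast hk
  constructor
  · rw [sum_integral_exceptionalPart_div, div_le_one hτ]
    by_contra hc
    have h1 : (2 : ℝ) ^ i / 2 ≤ expectedMax μ X Q :=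
      half_le_integral_of_le_sum_exceptionalPart h hX hXi
        (integrable_iSup_parts hX hX0 hXi Q) (iSup_parts_nonneg hX0 Q) (le_iSup_parts hX0 Q)
        (not_le.1 hc).le
    linarith
  · have hw0 := vertexWeight_nonneg (μ := μ) hX hX0 hk i
    have hsum := sum_vertexWeight_le h hX hX0 hXi Q (i := i) (by linarith)
    rw [hQ] at hsum
    have hs0 : 0 ≤ ∑ v, vertexWeight μ X k i v := Finset.sum_nonneg fun v _ => hw0 v
    -- Zero total weight makes the part bound 0, whatever `ε` is; it is still met since every weight
    -- is 0. Otherwise `ε` is tuned so that the bound is exactly 18.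
    rcases hs0.eq_or_lt with hz | hpos
    · refine dynamicPartition_ne_none G ord τ hk hkn (m := 0) le_rfl (fun v => ?_) ?_ hw0
      · exact ((Finset.sum_eq_zero_iff_of_nonneg fun v _ => hw0 v).1 hz.symm v
          (Finset.mem_univ v)).le
      · rw [← hz]
        simp
    · refine dynamicPartition_ne_none G ord τ hk hkn (m := 1) zero_le_one
        (vertexWeight_le_one hX hX0 hk i) ?_ hw0
      unfold balanceParam
      set W := ∑ v, vertexWeight μ X k i v
      have h18 : (1 + (18 * (k : ℝ) - W) / W) * (1 / (k : ℝ) * W) = 18 := by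
        field_simp
        ring
      rw [h18]
      have : 1 / (k : ℝ) * W ≤ 17 := by
        rw [one_div_mul_eq_div, div_le_iff₀ hk0]
        exact hsum
      linarith

lemma two_zpow_le_optS_of_not_scaleAccepted (h : iIndepFun X μ) (hX : ∀ v, Measurable (X v))
    (hX0 : ∀ v ω, 0 ≤ X v ω) (hXi : ∀ v, Integrable (X v) μ) (hk : 1 ≤ k)
    (hkn : k ≤ Fintype.card V) {i : ℤ} (hi : ¬ ScaleAccepted G ord τ μ X k i) :
    (2 : ℝ) ^ i ≤ 16 * optS μ X k := by
  obtain ⟨P, hP⟩ := exists_finpartition_card ord hk hkn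
  have : (2 : ℝ) ^ i / 16 ≤ optS μ X k := le_optS P hP fun Q hQ => by
    by_contra hc
    exact hi (scaleAccepted_of_expectedMax_lt h hX hX0 hXi hk hkn Q hQ (by linarith))
  linarith

/-- The cost of the output of Dynamic Partition at an accepted scale. -/
lemma exists_finpartition_of_scaleAccepted (h : iIndepFun X μ) (hX : ∀ v, Measurable (X v))
    (hX0 : ∀ v ω, 0 ≤ X v ω) (hXi : ∀ v, Integrable (X v) μ) (hk : 1 ≤ k) {i : ℤ}
    (hi : ScaleAccepted G ord τ μ X k i) :
    ∃ P : Finpartition (Finset.univ : Finset V), P.parts.card = k ∧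
      partitionAtScale G ord τ μ X k i = some P.parts ∧
      (expectedMax μ X P ≤ optS μ X k ∨ expectedMax μ X P ≤ 22 * (2 : ℝ) ^ i) := by
  obtain ⟨P, hPs, hPk, hw⟩ := exists_finpartition_of_dynamicPartition G ord τ k _ _ hi.2
  refine ⟨P, hPk, hPs, ?_⟩
  rcases hk.eq_or_lt with rfl | hk2
  · exact Or.inl (le_optS P hPk fun Q hQ => by rw [eq_of_card_parts_eq_one hPk hQ])
  · right
    subst hPk
    refine expectedMax_le h hX hX0 hXi P hk2 (fun B hB => (hw B hB).trans ?_) hi.1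
    unfold balanceParam
    set W := ∑ v, vertexWeight μ X P.parts.card i v
    by_cases hW : W = 0
    · simp [hW]
    · have : (P.parts.card : ℝ) ≠ 0 := by positivity
      apply le_of_eq
      field_simp
      ring

/-- The normal part is at most `2^i` pointwise and the exceptional part in mean. This excludes
arbitrarily small accepted scales when some mean is positive. -/
lemma integral_le_of_scaleAccepted (hX : ∀ v, Measurable (X v)) (hX0 : ∀ v ω, 0 ≤ X v ω)
    (hXi : ∀ v, Integrable (X v) μ) {i : ℤ} (hi : ScaleAccepted G ord τ μ X k i) (v : V) :
    ∫ ω, X v ω ∂μ ≤ 2 * (2 : ℝ) ^ i := by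
  have hτ : (0 : ℝ) < 2 ^ i := by positivity
  have hS := hi.1
  rw [sum_integral_exceptionalPart_div, div_le_one hτ] at hS
  have hSi := integrable_exceptionalPart hX hX0 hXi i v
  have h1 : ∫ ω, exceptionalPart X i v ω ∂μ ≤ (2 : ℝ) ^ i :=
    (Finset.single_le_sum (f := fun v => ∫ ω, exceptionalPart X i v ω ∂μ)
      (fun v _ => integral_nonneg fun ω => exceptionalPart_nonneg hX0 i v ω)
      (Finset.mem_univ v)).trans hS
  calc ∫ ω, X v ω ∂μ ≤ ∫ ω, ((2 : ℝ) ^ i + exceptionalPart X i v ω) ∂μ := by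
        refine integral_mono (hXi v) ((integrable_const _).add hSi) fun ω => ?_
        have h2 := normalPart_div_le_one (X := X) i v ω
        rw [div_le_one hτ] at h2
        have h3 := normalPart_add_exceptionalPart (X := X) i v ω
        dsimp only
        linarith
    _ ≤ 2 * (2 : ℝ) ^ i := by
        rw [integral_add (integrable_const _) hSi]
        simp only [integral_const, probReal_univ, one_smul]
        linarith

/-- Stochastic Partition succeeds if the range of scales contains all large scales, and the
accepted scales in it are bounded below. -/
lemma exists_stochasticPartition_eq (h : iIndepFun X μ) (hX : ∀ v, Measurable (X v))
    (hX0 : ∀ v ω, 0 ≤ X v ω) (hXi : ∀ v, Integrable (X v) μ) (hk : 1 ≤ k)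
    (hkn : k ≤ Fintype.card V) {I : Set ℤ} (hI : Set.Ici 0 ⊆ I)
    (hbdd : ∃ b, ∀ i ∈ I, ScaleAccepted G ord τ μ X k i → b ≤ i) :
    ∃ P : Finpartition (Finset.univ : Finset V), P.parts.card = k ∧
      stochasticPartition I G ord τ μ X k = some P.parts ∧
      ∃ i ∈ I, (∀ j ∈ I, ScaleAccepted G ord τ μ X k j → i ≤ j) ∧
        (expectedMax μ X P ≤ optS μ X k ∨ expectedMax μ X P ≤ 22 * (2 : ℝ) ^ i) := by
  have hleast : ∃ i, IsLeast {i : ℤ | i ∈ I ∧ ScaleAccepted G ord τ μ X k i} i := by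
    obtain ⟨b, hb⟩ := hbdd
    obtain ⟨Q, hQ⟩ := exists_finpartition_card ord hk hkn
    obtain ⟨n, hn⟩ := pow_unbounded_of_one_lt (16 * expectedMax μ X Q) (one_lt_two (α := ℝ))
    obtain ⟨i, hi, hmin⟩ := Int.exists_least_of_bdd
      (P := fun i => i ∈ I ∧ ScaleAccepted G ord τ μ X k i) ⟨b, fun i hi => hb i hi.1 hi.2⟩
      ⟨n, hI (by simp), scaleAccepted_of_expectedMax_lt h hX hX0 hXi hk hkn Q hQ (by simpa using hn)⟩
    exact ⟨i, hi, fun j hj => hmin j hj⟩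
  have hspec := hleast.choose_spec
  obtain ⟨P, hPk, hPs, hP⟩ :=
    exists_finpartition_of_scaleAccepted h hX hX0 hXi hk hspec.1.2
  refine ⟨P, hPk, ?_, hleast.choose, hspec.1.1, fun j hj hja => hspec.2 ⟨hj, hja⟩, hP⟩
  rw [stochasticPartition, dif_pos hleast, hPs]

lemma expectedMax_le_optS_of_not_scaleAccepted (h : iIndepFun X μ) (hX : ∀ v, Measurable (X v))
    (hX0 : ∀ v ω, 0 ≤ X v ω) (hXi : ∀ v, Integrable (X v) μ) (hk : 1 ≤ k)
    (hkn : k ≤ Fintype.card V) {i : ℤ} (hi : ¬ ScaleAccepted G ord τ μ X k (i - 1))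
    {P : Finpartition (Finset.univ : Finset V)}
    (hP : expectedMax μ X P ≤ optS μ X k ∨ expectedMax μ X P ≤ 22 * (2 : ℝ) ^ i) :
    expectedMax μ X P ≤ 704 * optS μ X k := by
  have h1 := two_zpow_le_optS_of_not_scaleAccepted h hX hX0 hXi hk hkn hi
  rw [zpow_sub_one₀ two_ne_zero] at h1
  have h2 : (0 : ℝ) < 2 ^ i := by positivity
  rcases hP with hP | hP <;> linarith

end Algorithm

end StochPart

theorem theorem5 :
    ∃ C : ℝ, 0 < C ∧
      ∀ (V : Type*) [Fintype V] [DecidableEq V] (Ω : Type*) [MeasurableSpace Ω]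
        (μ : Measure Ω) [IsProbabilityMeasure μ]
        (G : SimpleGraph V) (ord : Fin (Fintype.card V) ≃ V) (τ : StochPart.TieBreak)
        (k : ℕ) (X : V → Ω → ℝ),
        1 ≤ k → k ≤ Fintype.card V →
        (∀ v, Measurable (X v)) → (∀ v ω, 0 ≤ X v ω) → (∀ v, Integrable (X v) μ) →
        iIndepFun X μ →
        -- scales `2^i` with `i = 0, 1, 2, …`
        (∃ P : Finpartition (Finset.univ : Finset V), P.parts.card = k ∧
          StochPart.stochasticPartition (Set.Ici 0) G ord τ μ X k = some P.parts ∧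
          StochPart.expectedMax μ X P ≤ C * max 1 (StochPart.optS μ X k) ∧
          (¬ StochPart.ScaleAccepted G ord τ μ X k 0 →
            StochPart.expectedMax μ X P ≤ C * StochPart.optS μ X k)) ∧
        -- scales `2^i` with `i` an arbitrary integer
        ((∃ v, ¬ X v =ᵐ[μ] 0) →
          ∃ P : Finpartition (Finset.univ : Finset V), P.parts.card = k ∧
            StochPart.stochasticPartition Set.univ G ord τ μ X k = some P.parts ∧
            StochPart.expectedMax μ X P ≤ C * StochPart.optS μ X k) := by
  -- 704 = 22 * 2 * 16: cost at the accepted scale, one doubling, rejection one scale below.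
  refine ⟨704, by norm_num, ?_⟩
  intro V _ _ Ω _ μ _ G ord τ k X hk hkn hX hX0 hXi h
  constructor
  · obtain ⟨P, hPk, hPs, i, hi0, hmin, hP⟩ := StochPart.exists_stochasticPartition_eq
      (G := G) (ord := ord) (τ := τ) h hX hX0 hXi hk hkn (I := Set.Ici 0) subset_rfl
      ⟨0, fun i hi _ => hi⟩
    have hpos : 0 < i → StochPart.expectedMax μ X P ≤ 704 * StochPart.optS μ X k := fun hi =>
      StochPart.expectedMax_le_optS_of_not_scaleAccepted h hX hX0 hXi hk hkn
        (fun hacc => by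
          have := hmin (i - 1) (Set.mem_Ici.2 (by omega)) hacc
          omega) hP
    have hzero : ¬ 0 < i → i = 0 := fun hi => le_antisymm (not_lt.1 hi) hi0
    refine ⟨P, hPk, hPs, ?_, fun hna => ?_⟩
    · have h1 := le_max_left 1 (StochPart.optS μ X k)
      have h2 := le_max_right 1 (StochPart.optS μ X k)
      by_cases hi : 0 < i
      · linarith [hpos hi]
      · rw [hzero hi, zpow_zero] at hP
        rcases hP with hP | hP <;> linarith
    · by_cases hi : 0 < i
      · exact hpos hi
      -- Here `i = 0` and scale 0 is rejected, which already gives `1 ≤ 16 Opt`; no appeal to the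
      -- acceptance of `i` is needed.
      · have h1 := StochPart.two_zpow_le_optS_of_not_scaleAccepted h hX hX0 hXi hk hkn hna
        rw [hzero hi] at hP
        rw [zpow_zero] at hP h1
        rcases hP with hP | hP <;> linarith
  · rintro ⟨v, hv⟩
    have hEv : 0 < ∫ ω, X v ω ∂μ := by
      refine (integral_nonneg (hX0 v)).lt_of_ne fun h0 => hv ?_
      exact (integral_eq_zero_iff_of_nonneg (hX0 v) (hXi v)).1 h0.symm
    -- With `2^(-n)` below half the mean of `X v`, no scale below `-n` can be accepted.
    obtain ⟨n, hn⟩ := exists_pow_lt_of_lt_one (half_pos hEv) (by norm_num : (1 / 2 : ℝ) < 1)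
    obtain ⟨P, hPk, hPs, i, -, hmin, hP⟩ := StochPart.exists_stochasticPartition_eq
      (G := G) (ord := ord) (τ := τ) h hX hX0 hXi hk hkn (I := Set.univ) (Set.subset_univ _)
      ⟨-n, fun i _ hi => by
        have h1 := StochPart.integral_le_of_scaleAccepted hX hX0 hXi hi v
        by_contra hc
        have h2 : (2 : ℝ) ^ i ≤ 2 ^ (-(n : ℤ)) := zpow_le_zpow_right₀ one_le_two (by omega)
        rw [zpow_neg, zpow_natCast, ← inv_pow, ← one_div] at h2
        linarith⟩
    exact ⟨P, hPk, hPs, StochPart.expectedMax_le_optS_of_not_scaleAccepted h hX hX0 hXi hk hkn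
      (fun hacc => by
        have := hmin (i - 1) (Set.mem_univ _) hacc
        omega) hP⟩
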